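/- Let $d\ge 0$, $K\ge1$, $T\ge2$ be integers, $\epsilon\in(0,1]$, $v>0$, $\delta\in(0,1)$, $\theta_*\in\mathbb{R}^d$ with $\|\theta_*\|\le1$, $L=\ln\frac{2KT\ln T}{\delta}$, and let $r=\lceil 8L\rceil$ be the number of times the chosen arm is played in each round. In round $t=1,2,\ldots$ every arm $a\in\{1,\ldots,K\}$ has a (possibly random) feature vector $x_{t,a}\in\mathbb{R}^d$ with $\|x_{t,a}\|\le1$, and its $j$-th play, $j=1,\ldots,r$, would return the payoff $r^j_{t,a}$. Assume that, conditionally on all feature vectors, the payoff vectors $(r^j_{t,a})_{a}$ of different plays $(t,j)$ are independent, $\mathrm{E}[r^j_{t,a}]=x_{t,a}^\top\theta_*$ and $\mathrm{E}\big[|r^j_{t,a}-\mathrm{E}[r^j_{t,a}]|^{1+\epsilon}\big]\le v$. *Basic algorithm (BMM).* Given a set $\Psi\subseteq\{1,\ldots,t-1\}$ of past rounds with played arms $a_\tau$, let $A=I_d+\sum_{\tau\in\Psi}x_{\tau,a_\tau}x_{\tau,a_\tau}^\top$, $\hat\theta^j=A^{-1}\sum_{\tau\in\Psi}r^j_{\tau,a_\tau}x_{\tau,a_\tau}$,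 $\hat r_{t,a}=$ a median of $\{x_{t,a}^\top\hat\theta^j\}_{j=1}^r$, $\alpha_t=(12v)^{\frac1{1+\epsilon}}t^{\frac{1-\epsilon}{2(1+\epsilon)}}$ and $w_{t,a}=(\alpha_t+1)\sqrt{x_{t,a}^\top A^{-1}x_{t,a}}$. *Master algorithm (SupBMM).* Let $T_0=\lfloor T/r\rfloor$ and $S=\lfloor\ln T_0\rfloor$. The algorithm runs for rounds $t=1,\ldots,T_0$ with index sets $\Psi^s$, $1\le s\le S$, all initially empty (for $s>S$ put $\Psi^s=\varnothing$ throughout). In round $t$ start with $s=1$ and $\hat A_1=\{1,\ldots,K\}$ and repeat, with $\hat r^s_{t,a},w^s_{t,a}$ computed by BMM from $\Psi^s$, until an arm is found: (i) if $w^s_{t,a}\le1/\sqrt{T_0}$ for all $a\in\hat A_s$, choose $a_t\in\hat A_s$ maximizing $\hat r^s_{t,a}+w^s_{t,a}$ and leave all index sets unchanged; (ii) otherwise, if $w^s_{t,a}>2^{-s}$ for some $a\in\hat A_s$, choose such an arm as $a_t$ and add $t$ to $\Psi^s$ (if $s\le S$); (iii) otherwise put $\hat A_{s+1}=\{a\in\hat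 A_s:\hat r^s_{t,a}+w^s_{t,a}\ge\max_{a'\in\hat A_s}(\hat r^s_{t,a'}+w^s_{t,a'})-2^{1-s}\}$ and replace $s$ by $s+1$. Then $a_t$ is played $r$ times. Ties among medians and among eligible arms are broken by arbitrary rules fixed in advance (a measurable function of the values for medians, and functions of $t$, $s$ and the set of eligible arms for arms). The $T-rT_0<r$ plays left over use the feature vectors of round $T_0+1$ and may use arbitrary arms. Let $R(T)$ be the sum over all $T$ plays of $\max_a x_{t,a}^\top\theta_*-x_{t,a'}^\top\theta_*$, where $t$ is the round of the play and $a'$ is the arm played. Then with probability at least $1-\delta$, whatever arms the left-over plays use, $$R(T)\le 120\left(1+(12v)^{\frac1{1+\epsilon}}\right)\ln T\,\sqrt{2d\ln\tfrac{2KT\ln T}{\delta}}\;T^{\frac1{1+\epsilon}}+5\sqrt{2T\ln\tfrac{2KT\ln T}{\delta}} .$$ -/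

import Mathlib

open MeasureTheory ProbabilityTheory
open scoped Matrix

noncomputable section

namespace SupBMM

/-- `x t a` is the feature vector of arm `a` in round `t`. Rounds are numbered from `0`, so that
round `t` here is round `t + 1` of the usual numbering. -/
abbrev Contexts (d K : ℕ) : Type := ℕ → Fin K → EuclideanSpace ℝ (Fin d)

/-- `y t j a` is the payoff that the `j`-th play of round `t` returns if arm `a` is played. -/
abbrev Payoffs (K r : ℕ) : Type := ℕ → Fin r → Fin K → ℝ

instance instStandardBorelSpacePayoffs (K r : ℕ) : StandardBorelSpace (Payoffs K r) :=
  have : StandardBorelSpace (Fin r → Fin K → ℝ) := StandardBorelSpace.pi_countable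
  StandardBorelSpace.pi_countable

/-- `m` is a median of the values `u j`: at least half of them are `≤ m`, and at least half of
them are `≥ m`. -/
def IsMedian {r : ℕ} (u : Fin r → ℝ) (m : ℝ) : Prop :=
  r ≤ 2 * Set.ncard {j | u j ≤ m} ∧ r ≤ 2 * Set.ncard {j | m ≤ u j}

/-- The choices which the algorithm leaves open, as rules fixed in advance: which median is taken
when there are several, which of the arms with a wide confidence interval is explored, and which of
the arms with maximal upper confidence bound is exploited (in a given round and stage). -/
structure Rules (K r : ℕ) where
  median : (Fin r → ℝ) → ℝ
  measurable_median : Measurable median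
  isMedian_median : ∀ u, IsMedian u (median u)
  explore : ℕ → ℕ → Finset (Fin K) → Fin K
  explore_mem : ∀ t s C, C.Nonempty → explore t s C ∈ C
  exploit : ℕ → ℕ → Finset (Fin K) → Fin K
  exploit_mem : ∀ t s C, C.Nonempty → exploit t s C ∈ C

section Algorithm

variable {d K r : ℕ}

/-! ### The basic algorithm

A set `Ψ` of past rounds is stored as a set of pairs `(τ, a_τ)`: a round and the arm played in it. -/

/-- `A = I + ∑_{τ ∈ Ψ} x_{τ,a_τ} x_{τ,a_τ}ᵀ`. -/
def gram (x : Contexts d K) (Ψ : Finset (ℕ × Fin K)) : Matrix (Fin d) (Fin d) ℝ :=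
  1 + ∑ p ∈ Ψ, Matrix.vecMulVec (x p.1 p.2).ofLp (x p.1 p.2).ofLp

/-- `θ̂^j = A⁻¹ ∑_{τ ∈ Ψ} r^j_{τ,a_τ} x_{τ,a_τ}`. -/
def lsEstimator (x : Contexts d K) (y : Payoffs K r) (Ψ : Finset (ℕ × Fin K)) (j : Fin r) :
    Fin d → ℝ :=
  (gram x Ψ)⁻¹ *ᵥ ∑ p ∈ Ψ, y p.1 j p.2 • (x p.1 p.2).ofLp

/-- The estimated payoff of arm `a` in round `t`: the median over `j` of `x_{t,a}ᵀ θ̂^j`. -/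
def estPayoff (R : Rules K r) (x : Contexts d K) (y : Payoffs K r) (Ψ : Finset (ℕ × Fin K))
    (t : ℕ) (a : Fin K) : ℝ :=
  R.median fun j => (x t a).ofLp ⬝ᵥ lsEstimator x y Ψ j

/-- `α_t = (12 v)^{1/(1+ε)} t^{(1-ε)/(2(1+ε))}`, where `t + 1` is the number of the round. -/
def alpha (ε v : ℝ) (t : ℕ) : ℝ :=
  (12 * v) ^ (1 / (1 + ε)) * ((t : ℝ) + 1) ^ ((1 - ε) / (2 * (1 + ε)))

/-- The width `w_{t,a} = (α_t + 1) √(x_{t,a}ᵀ A⁻¹ x_{t,a})`. -/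
def width (ε v : ℝ) (x : Contexts d K) (Ψ : Finset (ℕ × Fin K)) (t : ℕ) (a : Fin K) : ℝ :=
  (alpha ε v t + 1) * √((x t a).ofLp ⬝ᵥ ((gram x Ψ)⁻¹ *ᵥ (x t a).ofLp))

/-- The upper confidence bound of arm `a` in round `t`. -/
def ucb (ε v : ℝ) (R : Rules K r) (x : Contexts d K) (y : Payoffs K r) (Ψ : Finset (ℕ × Fin K))
    (t : ℕ) (a : Fin K) : ℝ :=
  estPayoff R x y Ψ t a + width ε v x Ψ t a

/-! ### The master algorithm, run for `N` rounds

`Ψ s` is the index set of stage `s`, with stages numbered from `1`. -/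

open Classical in
/-- The candidate arms `Â_s` of stage `s` in round `t` (value irrelevant for `s = 0`). -/
def candidates (ε v : ℝ) (R : Rules K r) (x : Contexts d K) (y : Payoffs K r)
    (Ψ : ℕ → Finset (ℕ × Fin K)) (t : ℕ) : ℕ → Finset (Fin K)
  | 0 => Finset.univ
  | 1 => Finset.univ
  | s + 2 => (candidates ε v R x y Ψ t (s + 1)).filter fun a =>
      ∀ a' ∈ candidates ε v R x y Ψ t (s + 1),
        ucb ε v R x y (Ψ (s + 1)) t a' - (2 : ℝ) ^ (1 - ((s + 1 : ℕ) : ℤ))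
          ≤ ucb ε v R x y (Ψ (s + 1)) t a

/-- All candidates of stage `s` have width at most `1 / √N`. -/
def AllNarrow (N : ℕ) (ε v : ℝ) (R : Rules K r) (x : Contexts d K) (y : Payoffs K r)
    (Ψ : ℕ → Finset (ℕ × Fin K)) (t s : ℕ) : Prop :=
  ∀ a ∈ candidates ε v R x y Ψ t s, width ε v x (Ψ s) t a ≤ 1 / √(N : ℝ)

open Classical in
/-- The candidates of stage `s` with width larger than `2^{-s}`. -/
def wideArms (ε v : ℝ) (R : Rules K r) (x : Contexts d K) (y : Payoffs K r)
    (Ψ : ℕ → Finset (ℕ × Fin K)) (t s : ℕ) : Finset (Fin K) :=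
  (candidates ε v R x y Ψ t s).filter fun a => (2 : ℝ) ^ (-(s : ℤ)) < width ε v x (Ψ s) t a

open Classical in
/-- The candidates of stage `s` with maximal upper confidence bound. -/
def bestArms (ε v : ℝ) (R : Rules K r) (x : Contexts d K) (y : Payoffs K r)
    (Ψ : ℕ → Finset (ℕ × Fin K)) (t s : ℕ) : Finset (Fin K) :=
  (candidates ε v R x y Ψ t s).filter fun a =>
    ∀ a' ∈ candidates ε v R x y Ψ t s, ucb ε v R x y (Ψ s) t a' ≤ ucb ε v R x y (Ψ s) t a

/-- The stage at which the arm of round `t` is found: the first one at which all candidates are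
narrow or some candidate is wide. (If `N ≥ 1`, every stage with `2^{-s} ≤ 1 / √N` qualifies.) -/
def stopStage (N : ℕ) (ε v : ℝ) (R : Rules K r) (x : Contexts d K) (y : Payoffs K r)
    (Ψ : ℕ → Finset (ℕ × Fin K)) (t : ℕ) : ℕ :=
  sInf {s | 1 ≤ s ∧ (AllNarrow N ε v R x y Ψ t s ∨ (wideArms ε v R x y Ψ t s).Nonempty)}

open Classical in
/-- The arm chosen in round `t`, given the index sets. -/
def chooseArm (N : ℕ) (ε v : ℝ) (R : Rules K r) (x : Contexts d K) (y : Payoffs K r)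
    (Ψ : ℕ → Finset (ℕ × Fin K)) (t : ℕ) : Fin K :=
  if AllNarrow N ε v R x y Ψ t (stopStage N ε v R x y Ψ t) then
    R.exploit t (stopStage N ε v R x y Ψ t)
      (bestArms ε v R x y Ψ t (stopStage N ε v R x y Ψ t))
  else
    R.explore t (stopStage N ε v R x y Ψ t)
      (wideArms ε v R x y Ψ t (stopStage N ε v R x y Ψ t))

/-- The number `S = ⌊ln N⌋` of index sets which the algorithm maintains. -/
def numStages (N : ℕ) : ℕ := ⌊Real.log N⌋₊

open Classical in
/-- The index sets after round `t`, given those before it: unchanged after an exploitation; after an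
exploration at stage `s` the round is added to the index set of stage `s`, if `s ≤ S`. -/
def updateIndex (N : ℕ) (ε v : ℝ) (R : Rules K r) (x : Contexts d K) (y : Payoffs K r)
    (Ψ : ℕ → Finset (ℕ × Fin K)) (t : ℕ) : ℕ → Finset (ℕ × Fin K) := fun s' =>
  if ¬ AllNarrow N ε v R x y Ψ t (stopStage N ε v R x y Ψ t) ∧
      s' = stopStage N ε v R x y Ψ t ∧ s' ≤ numStages N then
    insert (t, chooseArm N ε v R x y Ψ t) (Ψ s')
  else Ψ s'

/-- The index sets at the beginning of round `t`. -/
def index (N : ℕ) (ε v : ℝ) (R : Rules K r) (x : Contexts d K) (y : Payoffs K r) :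
    ℕ → ℕ → Finset (ℕ × Fin K)
  | 0 => fun _ => ∅
  | t + 1 => updateIndex N ε v R x y (index N ε v R x y t) t

/-- The arm which the algorithm plays (`r` times) in round `t`. -/
def arm (N : ℕ) (ε v : ℝ) (R : Rules K r) (x : Contexts d K) (y : Payoffs K r) (t : ℕ) : Fin K :=
  chooseArm N ε v R x y (index N ε v R x y t) t

/-- The loss in expected payoff from playing `a` instead of a best arm, with contexts `x t`. -/
def gap (θ : EuclideanSpace ℝ (Fin d)) (x : Contexts d K) (t : ℕ) (a : Fin K) : ℝ :=
  (⨆ a' : Fin K, inner ℝ (x t a') θ) - inner ℝ (x t a) θ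

/-- The regret over `T` plays. Play `n` belongs to round `n / r`; the `⌊T/r⌋` complete rounds follow
the algorithm with horizon `⌊T/r⌋`, and the fewer than `r` plays left over use the arms `rest n`. -/
def regret (T : ℕ) (ε v : ℝ) (R : Rules K r) (θ : EuclideanSpace ℝ (Fin d)) (x : Contexts d K)
    (y : Payoffs K r) (rest : ℕ → Fin K) : ℝ :=
  ∑ n ∈ Finset.range T, gap θ x (n / r)
    (if n / r < T / r then arm (T / r) ε v R x y (n / r) else rest n)

end Algorithm

/-- The number of plays per round, `r = ⌈8 ln (2KT ln T / δ)⌉`. -/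
def numPlays (K T : ℕ) (δ : ℝ) : ℕ := ⌈8 * Real.log (2 * K * T * Real.log T / δ)⌉₊

/-- The assumptions on the law `ν` of the payoffs for fixed contexts `x`: different plays are
independent, and every payoff has mean `x_{t,a}ᵀ θ` and `(1 + ε)`-th central moment at most `v`. -/
structure IsHeavyTailedLinear {d K r : ℕ} (ν : Measure (Payoffs K r)) (x : Contexts d K)
    (θ : EuclideanSpace ℝ (Fin d)) (ε v : ℝ) : Prop where
  indep : iIndepFun (fun (p : ℕ × Fin r) (y : Payoffs K r) => y p.1 p.2) ν
  integrable : ∀ t j a, Integrable (fun y : Payoffs K r => y t j a) ν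
  mean : ∀ t j a, ∫ y, y t j a ∂ν = inner ℝ (x t a) θ
  integrable_moment : ∀ t j a,
    Integrable (fun y : Payoffs K r => |y t j a - ∫ z, z t j a ∂ν| ^ (1 + ε)) ν
  moment : ∀ t j a, ∫ y, |y t j a - ∫ z, z t j a ∂ν| ^ (1 + ε) ∂ν ≤ v

end SupBMM

end

/-! For a fixed index set the error of each least-squares estimate splits into bias and noise
(`dotProduct_lsEstimator_sub`). With `σ = √(xᵀ A⁻¹ x)` the bias is at most `σ`. The noise is a
weighted sum of independent centred payoffs whose squared weights sum to at most `σ²`; the von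
Bahr–Esseen inequality, a power-mean bound and Markov's inequality show that it exceeds `α_t σ` with
probability at most `1/4`. The median of `r` independent copies fails only if half of them do, which
has probability at most `exp (-r/8)`.

The index set is random, however, and chosen with the help of payoffs. The stages resolve this:
selection for stage `s` looks at the estimates of lower stages only, and widths do not involve
payoffs. Hence, given the contexts, the event that the set of stage `s` equals `B` is determined by
payoffs outside the rounds of `B` (`index_congr`, `measurableSet_index_eq_playsSigma`). Conditioning
on this event leaves the plays in `B` independent with their original law, so the fixed-set bound
applies and is summed over `B` (`measure_badSet_section_le`). A union bound over rounds, maintained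
stages and arms costs at most `δ`; at stages beyond `S` the index set is empty and the interval is
valid with certainty.

When all intervals are valid, a best arm is never eliminated, every candidate of stage `s` has gap
at most `8 · 2⁻ˢ`, and an arm explored at stage `s` has width above `2⁻ˢ`. So every gap is at most 8
times the width, up to `8 / √N` for exploitation and for stages beyond `S` (`Valid.gap_le`). The
elliptical potential and Cauchy–Schwarz bound the sum of the widths (`sum_width_le`); multiplying by
`r` and using `r N ≤ T` gives the theorem. -/

namespace SupBMM

/-! ### Linear algebra of the regularized Gram matrix -/

section Gram

variable {d K r : ℕ} (x : Contexts d K) (Ψ : Finset (ℕ × Fin K))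

/-- The squared confidence norm `uᵀ A⁻¹ u`. -/
noncomputable def invQuad (u : Fin d → ℝ) : ℝ := u ⬝ᵥ ((gram x Ψ)⁻¹ *ᵥ u)

lemma gram_mulVec (z : Fin d → ℝ) :
    gram x Ψ *ᵥ z = z + ∑ p ∈ Ψ, ((x p.1 p.2).ofLp ⬝ᵥ z) • (x p.1 p.2).ofLp := by
  simp [gram, Matrix.add_mulVec, Matrix.sum_mulVec, Matrix.vecMulVec_mulVec]

lemma gram_posDef : (gram x Ψ).PosDef := by
  refine Matrix.PosDef.one.add_posSemidef (Matrix.posSemidef_sum _ fun p _ => ?_)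
  simpa using Matrix.posSemidef_vecMulVec_self_star (x p.1 p.2).ofLp

lemma gram_det_pos : 0 < (gram x Ψ).det := (gram_posDef x Ψ).det_pos

lemma gram_mulVec_inv (u : Fin d → ℝ) : gram x Ψ *ᵥ ((gram x Ψ)⁻¹ *ᵥ u) = u := by
  rw [Matrix.mulVec_mulVec, Matrix.mul_nonsing_inv _ (gram_det_pos x Ψ).ne'.isUnit,
    Matrix.one_mulVec]

lemma dotProduct_gram_inv (u w : Fin d → ℝ) :
    u ⬝ᵥ ((gram x Ψ)⁻¹ *ᵥ w) = ((gram x Ψ)⁻¹ *ᵥ u) ⬝ᵥ w := by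
  have h : ((gram x Ψ)⁻¹)ᵀ = (gram x Ψ)⁻¹ := by
    have := (gram_posDef x Ψ).isHermitian
    rw [Matrix.transpose_nonsing_inv]
    congr 1
  rw [Matrix.dotProduct_mulVec, ← Matrix.mulVec_transpose, h]

/-- Expand `u = A (A⁻¹ u)`. The choice `w = θ` yields the split into bias and noise, and `w = A⁻¹ u`
the formula for the confidence norm. -/
lemma eq_add_sum_gram_inv (u w : Fin d → ℝ) :
    u ⬝ᵥ w = ((gram x Ψ)⁻¹ *ᵥ u) ⬝ᵥ w +
      ∑ p ∈ Ψ, ((x p.1 p.2).ofLp ⬝ᵥ ((gram x Ψ)⁻¹ *ᵥ u)) * ((x p.1 p.2).ofLp ⬝ᵥ w) := by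
  conv_lhs => rw [← gram_mulVec_inv x Ψ u, gram_mulVec]
  simp [add_dotProduct, sum_dotProduct]

lemma invQuad_eq (u : Fin d → ℝ) :
    invQuad x Ψ u = ((gram x Ψ)⁻¹ *ᵥ u) ⬝ᵥ ((gram x Ψ)⁻¹ *ᵥ u) +
      ∑ p ∈ Ψ, ((x p.1 p.2).ofLp ⬝ᵥ ((gram x Ψ)⁻¹ *ᵥ u)) ^ 2 := by
  rw [invQuad, eq_add_sum_gram_inv x Ψ]
  simp [sq]

lemma real_dotProduct_self_nonneg (u : Fin d → ℝ) : 0 ≤ u ⬝ᵥ u :=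
  Finset.sum_nonneg fun _ _ => mul_self_nonneg _

lemma invQuad_nonneg (u : Fin d → ℝ) : 0 ≤ invQuad x Ψ u := by
  rw [invQuad_eq]
  exact add_nonneg (real_dotProduct_self_nonneg _) (Finset.sum_nonneg fun _ _ => sq_nonneg _)

lemma sum_sq_le_invQuad (u : Fin d → ℝ) :
    ∑ p ∈ Ψ, ((x p.1 p.2).ofLp ⬝ᵥ ((gram x Ψ)⁻¹ *ᵥ u)) ^ 2 ≤ invQuad x Ψ u := by
  rw [invQuad_eq]
  exact le_add_of_nonneg_left (real_dotProduct_self_nonneg _)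

lemma dotProduct_eq_inner (u w : Fin d → ℝ) :
    u ⬝ᵥ w = inner ℝ (WithLp.toLp 2 u : EuclideanSpace ℝ (Fin d)) (WithLp.toLp 2 w) := by
  simp [EuclideanSpace.inner_eq_star_dotProduct, dotProduct_comm]

lemma ofLp_dotProduct_ofLp (u w : EuclideanSpace ℝ (Fin d)) :
    u.ofLp ⬝ᵥ w.ofLp = inner ℝ u w := dotProduct_eq_inner _ _

/-- The bias caused by the regularizer `I`: Cauchy–Schwarz, and `‖A⁻¹ u‖²` is one of the two
summands in `invQuad_eq`. -/
lemma abs_gram_inv_dotProduct_le (u : Fin d → ℝ) {θ : EuclideanSpace ℝ (Fin d)} (hθ : ‖θ‖ ≤ 1) :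
    |((gram x Ψ)⁻¹ *ᵥ u) ⬝ᵥ θ.ofLp| ≤ √(invQuad x Ψ u) := by
  set z := (gram x Ψ)⁻¹ *ᵥ u with hz
  have h1 : |z ⬝ᵥ θ.ofLp| ≤ ‖(WithLp.toLp 2 z : EuclideanSpace ℝ (Fin d))‖ := by
    rw [dotProduct_eq_inner]
    refine (abs_real_inner_le_norm _ _).trans ?_
    exact mul_le_of_le_one_right (norm_nonneg _) hθ
  refine h1.trans (Real.le_sqrt_of_sq_le ?_)
  rw [← real_inner_self_eq_norm_sq, ← dotProduct_eq_inner, invQuad_eq]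
  exact le_add_of_nonneg_right (Finset.sum_nonneg fun _ _ => sq_nonneg _)

lemma invQuad_le_sq_norm (u : EuclideanSpace ℝ (Fin d)) : invQuad x Ψ u.ofLp ≤ ‖u‖ ^ 2 := by
  set z := (gram x Ψ)⁻¹ *ᵥ u.ofLp with hz
  have h0 := invQuad_eq x Ψ u.ofLp
  have h1 : z ⬝ᵥ z ≤ invQuad x Ψ u.ofLp := by
    rw [h0]; exact le_add_of_nonneg_right (Finset.sum_nonneg fun _ _ => sq_nonneg _)
  have h2 : 0 ≤ (z - u.ofLp) ⬝ᵥ (z - u.ofLp) := real_dotProduct_self_nonneg _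
  have h3 : invQuad x Ψ u.ofLp = u.ofLp ⬝ᵥ z := rfl
  have h4 : u.ofLp ⬝ᵥ u.ofLp = ‖u‖ ^ 2 := by
    rw [ofLp_dotProduct_ofLp, real_inner_self_eq_norm_sq]
  simp only [sub_dotProduct, dotProduct_sub] at h2
  rw [dotProduct_comm z u.ofLp] at h2
  linarith

lemma gram_insert {p : ℕ × Fin K} (hp : p ∉ Ψ) :
    gram x (insert p Ψ) = gram x Ψ + Matrix.vecMulVec (x p.1 p.2).ofLp (x p.1 p.2).ofLp := by
  rw [gram, Finset.sum_insert hp, gram]; abel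

/-- The matrix determinant lemma for a rank-one update. It makes the confidence norms telescope in
`log det`. -/
lemma det_gram_insert {p : ℕ × Fin K} (hp : p ∉ Ψ) :
    (gram x (insert p Ψ)).det = (gram x Ψ).det * (1 + invQuad x Ψ (x p.1 p.2).ofLp) := by
  rw [gram_insert x Ψ hp, Matrix.vecMulVec_eq Unit,
    Matrix.det_add_replicateCol_mul_replicateRow (gram_det_pos x Ψ).ne'.isUnit, invQuad,
    Matrix.dotProduct_mulVec]
  congr 2
  simp [Matrix.det_unique, Matrix.mul_apply, dotProduct, Matrix.vecMul]

lemma trace_gram_le (hx : ∀ p ∈ Ψ, ‖x p.1 p.2‖ ≤ 1) : (gram x Ψ).trace ≤ d + Ψ.card := by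
  rw [gram, Matrix.trace_add, Matrix.trace_one, Matrix.trace_sum, Fintype.card_fin]
  gcongr
  calc _ ≤ ∑ p ∈ Ψ, (1 : ℝ) := Finset.sum_le_sum fun p hp => by
        rw [Matrix.trace_vecMulVec, ofLp_dotProduct_ofLp, real_inner_self_eq_norm_sq]
        exact pow_le_one₀ (norm_nonneg _) (hx p hp)
    _ = _ := by simp

/-- The eigenvalues sum to at most `d + |Ψ| ≤ d (1 + |Ψ|)`; bound the logarithm of each by the
tangent line at `1 + |Ψ|` and add up. -/
lemma log_det_gram_le (hx : ∀ p ∈ Ψ, ‖x p.1 p.2‖ ≤ 1) :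
    Real.log (gram x Ψ).det ≤ d * Real.log (1 + Ψ.card) := by
  rcases Nat.eq_zero_or_pos d with rfl | hd
  · simp
  have hH := (gram_posDef x Ψ).isHermitian
  have hpos : ∀ i, 0 < hH.eigenvalues i := (gram_posDef x Ψ).eigenvalues_pos
  have htr := trace_gram_le x Ψ hx
  rw [hH.trace_eq_sum_eigenvalues] at htr
  rw [hH.det_eq_prod_eigenvalues]
  simp only [RCLike.ofReal_real_eq_id, id_eq] at htr ⊢
  rw [Real.log_prod fun i _ => (hpos i).ne']
  have hc : (0 : ℝ) < 1 + Ψ.card := by positivity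
  have hlog : ∀ i, Real.log (hH.eigenvalues i) ≤
      Real.log (1 + Ψ.card) + (hH.eigenvalues i / (1 + Ψ.card) - 1) := fun i => by
    have := Real.log_le_sub_one_of_pos (div_pos (hpos i) hc)
    rw [Real.log_div (hpos i).ne' hc.ne'] at this
    linarith
  refine (Finset.sum_le_sum fun i _ => hlog i).trans ?_
  rw [Finset.sum_add_distrib, Finset.sum_sub_distrib, ← Finset.sum_div]
  simp only [Finset.sum_const, Finset.card_univ, Fintype.card_fin, nsmul_eq_mul, mul_one]
  have : (∑ i, hH.eigenvalues i) / (1 + Ψ.card) ≤ d := by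
    rw [div_le_iff₀ hc]
    refine htr.trans ?_
    have : (1 : ℝ) ≤ d := by exact_mod_cast hd
    nlinarith [(Nat.cast_nonneg Ψ.card : (0 : ℝ) ≤ Ψ.card)]
  linarith

/-- Since `0 ≤ q ≤ 1`, `q ≤ 2 log (1 + q)`; summed over rounds, the right-hand side telescopes. -/
lemma invQuad_le_log_det_sub {p : ℕ × Fin K} (hp : p ∉ Ψ) (hx : ‖x p.1 p.2‖ ≤ 1) :
    invQuad x Ψ (x p.1 p.2).ofLp ≤
      2 * (Real.log (gram x (insert p Ψ)).det - Real.log (gram x Ψ).det) := by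
  set q := invQuad x Ψ (x p.1 p.2).ofLp with hq
  have h0 : 0 ≤ q := invQuad_nonneg _ _ _
  have h1 : q ≤ 1 := (invQuad_le_sq_norm x Ψ _).trans (pow_le_one₀ (norm_nonneg _) hx)
  rw [det_gram_insert x Ψ hp, Real.log_mul (gram_det_pos x Ψ).ne' (by positivity), ← hq]
  have h2 := Real.one_sub_inv_le_log_of_pos (show 0 < 1 + q by positivity)
  have h3 : q / 2 ≤ 1 - (1 + q)⁻¹ := by
    rw [le_sub_iff_add_le, ← le_sub_iff_add_le', inv_eq_one_div, div_le_iff₀ (by positivity)]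
    nlinarith
  linarith

/-- The estimation error is a noise term plus a bias term. -/
lemma dotProduct_lsEstimator_sub (y : Payoffs K r) (j : Fin r) (u : Fin d → ℝ)
    (θ : EuclideanSpace ℝ (Fin d)) :
    u ⬝ᵥ lsEstimator x y Ψ j - u ⬝ᵥ θ.ofLp =
      (∑ p ∈ Ψ, ((x p.1 p.2).ofLp ⬝ᵥ ((gram x Ψ)⁻¹ *ᵥ u)) *
        (y p.1 j p.2 - inner ℝ (x p.1 p.2) θ)) - ((gram x Ψ)⁻¹ *ᵥ u) ⬝ᵥ θ.ofLp := by
  rw [eq_add_sum_gram_inv x Ψ u θ.ofLp, lsEstimator, dotProduct_gram_inv, dotProduct_sum]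
  simp only [dotProduct_smul, smul_eq_mul, mul_sub, Finset.sum_sub_distrib, ofLp_dotProduct_ofLp]
  simp only [dotProduct_comm ((gram x Ψ)⁻¹ *ᵥ u) (x _ _).ofLp, mul_comm]
  ring

end Gram

end SupBMM

/-! ### Heavy-tailed sums and medians -/

section HeavyTail

/-- Write `|1 + t|^p` as `|1 + t| · |1 + t|^(p-1)` with `0 ≤ p - 1 ≤ 1`. Bernoulli's inequality
settles `|t| ≤ 1`, subadditivity of the power `p - 1` settles `t > 1`, and monotonicity with
Bernoulli for `p` settles `t < -1`. -/
lemma one_add_abs_rpow_le {p : ℝ} (hp : 1 ≤ p) (hp2 : p ≤ 2) (t : ℝ) :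
    |1 + t| ^ p ≤ 1 + p * t + 2 * |t| ^ p := by
  have hp0 : 0 < p := by linarith
  have hsplit : ∀ {s : ℝ}, 0 < s → s ^ p = s * s ^ (p - 1) := fun {s} hs => by
    rw [Real.rpow_sub_one hs.ne']; field_simp
  rcases le_or_gt |t| 1 with ht | ht
  · obtain ⟨h1, h2⟩ := abs_le.mp ht
    rcases eq_or_lt_of_le h1 with h1 | h1
    · subst h1
      norm_num [Real.zero_rpow hp0.ne']
      linarith
    have hs : 0 < 1 + t := by linarith
    rw [abs_of_pos hs, hsplit hs]
    have hb := rpow_one_add_le_one_add_mul_self (s := t) (by linarith)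
      (show (0 : ℝ) ≤ p - 1 by linarith) (by linarith)
    have hq : t ^ 2 ≤ |t| ^ p := by
      rw [← sq_abs, ← Real.rpow_natCast]
      exact Real.rpow_le_rpow_of_exponent_ge' (abs_nonneg _) ht hp0.le (by exact_mod_cast hp2)
    have := mul_le_mul_of_nonneg_left hb hs.le
    nlinarith [sq_nonneg t]
  rcases lt_abs.mp ht with h | h
  · have ht0 : 0 < t := by linarith
    rw [abs_of_pos (by linarith : 0 < 1 + t), hsplit (by linarith : 0 < 1 + t), abs_of_pos ht0]
    have hsub : (1 + t) ^ (p - 1) ≤ 1 + t ^ (p - 1) := by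
      simpa using Real.rpow_add_le_add_rpow (zero_le_one' ℝ) ht0.le
        (show (0 : ℝ) ≤ p - 1 by linarith) (by linarith)
    have h1 := mul_le_mul_of_nonneg_left hsub (by linarith : 0 ≤ 1 + t)
    have h2 : 0 ≤ t ^ (p - 1) := Real.rpow_nonneg ht0.le _
    rw [hsplit ht0]
    nlinarith
  · set s := -t with hs
    have hs0 : 0 < s := by linarith
    have hts : t = -s := by simp [hs]
    rw [hts, abs_neg, abs_of_pos hs0, abs_of_nonpos (by linarith : 1 + -s ≤ 0)]
    have h0 : 0 < -(1 + -s) := by linarith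
    rw [hsplit h0]
    have h1 : (-(1 + -s)) ^ (p - 1) ≤ s ^ (p - 1) :=
      Real.rpow_le_rpow h0.le (by linarith) (by linarith)
    have h2 := mul_le_mul_of_nonneg_left h1 h0.le
    have h3 := one_add_mul_self_le_rpow_one_add (s := s - 1) (by linarith) hp
    rw [add_sub_cancel] at h3
    have h4 : 0 ≤ s ^ (p - 1) := Real.rpow_nonneg hs0.le _
    rw [hsplit hs0] at *
    nlinarith

/-- The previous inequality scaled by `|a|^p`. The middle term is linear in `b`, so it has mean zero
when `b` is centred and independent of `a`. Writing `|a|^p * a⁻¹` for `sign a · |a|^(p-1)` stays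
correct at `a = 0` because `0⁻¹ = 0`. -/
lemma abs_add_rpow_le {p : ℝ} (hp : 1 ≤ p) (hp2 : p ≤ 2) (a b : ℝ) :
    |a + b| ^ p ≤ |a| ^ p + p * (|a| ^ p * a⁻¹ * b) + 2 * |b| ^ p := by
  rcases eq_or_ne a 0 with rfl | ha
  · have : 0 ≤ |b| ^ p := by positivity
    have hp0 : p ≠ 0 := by linarith
    simp [Real.zero_rpow hp0]
    linarith
  have h := mul_le_mul_of_nonneg_left (one_add_abs_rpow_le hp hp2 (b / a))
    (show 0 ≤ |a| ^ p by positivity)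
  rw [← Real.mul_rpow (abs_nonneg _) (abs_nonneg _), ← abs_mul, mul_add, mul_one,
    mul_div_cancel₀ _ ha] at h
  have h2 : |a| ^ p * |b / a| ^ p = |b| ^ p := by
    rw [← Real.mul_rpow (abs_nonneg _) (abs_nonneg _), ← abs_mul, mul_div_cancel₀ _ ha]
  calc _ ≤ _ := h
    _ = |a| ^ p + p * (|a| ^ p * a⁻¹ * b) + 2 * (|a| ^ p * |b / a| ^ p) := by ring
    _ = _ := by rw [h2]

lemma abs_rpow_mul_inv_le {p : ℝ} (hp : 1 ≤ p) (a : ℝ) : |(|a| ^ p * a⁻¹)| ≤ 1 + |a| ^ p := by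
  rcases eq_or_ne a 0 with rfl | ha
  · simp; positivity
  have ha' : 0 < |a| := abs_pos.mpr ha
  rw [abs_mul, abs_inv, abs_of_nonneg (by positivity : (0 : ℝ) ≤ |a| ^ p)]
  rcases le_or_gt |a| 1 with h | h
  · have h1 : |a| ^ p ≤ |a| := by
      simpa using Real.rpow_le_rpow_of_exponent_ge ha' h hp
    have h2 : |a| ^ p * |a|⁻¹ ≤ 1 := by
      rw [← div_eq_mul_inv, div_le_one ha']; exact h1
    have : 0 ≤ |a| ^ p := by positivity
    linarith
  · have : |a| ^ p * |a|⁻¹ ≤ |a| ^ p := mul_le_of_le_one_right (by positivity)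
      (inv_le_one_of_one_le₀ h.le)
    linarith

variable {Ω ι : Type*} {mΩ : MeasurableSpace Ω} {μ : Measure Ω}

/-- The von Bahr–Esseen inequality. -/
lemma integral_abs_sum_rpow_le {p : ℝ} (hp : 1 ≤ p) (hp2 : p ≤ 2) {X : ι → Ω → ℝ}
    (hX : iIndepFun X μ) (hm : ∀ i, Measurable (X i)) (hint : ∀ i, Integrable (X i) μ)
    (hmean : ∀ i, ∫ ω, X i ω ∂μ = 0) (hmom : ∀ i, Integrable (fun ω => |X i ω| ^ p) μ)
    (s : Finset ι) :
    Integrable (fun ω => |∑ i ∈ s, X i ω| ^ p) μ ∧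
      ∫ ω, |∑ i ∈ s, X i ω| ^ p ∂μ ≤ 2 * ∑ i ∈ s, ∫ ω, |X i ω| ^ p ∂μ := by
  classical
  have : IsProbabilityMeasure μ := hX.isProbabilityMeasure
  have hp0 : p ≠ 0 := by linarith
  induction s using Finset.induction_on with
  | empty => simp [Real.zero_rpow hp0]
  | insert i s hi ih =>
    obtain ⟨ih1, ih2⟩ := ih
    set S : Ω → ℝ := fun ω => ∑ j ∈ s, X j ω with hS
    have hSm : Measurable S := Finset.measurable_fun_sum _ fun j _ => hm j
    have hind : IndepFun S (X i) μ := by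
      have := hX.indepFun_finsetSum_of_notMem hm hi
      convert this using 1
      ext ω; simp [hS]
    have hφm : Measurable (fun a : ℝ => |a| ^ p * a⁻¹) := by fun_prop
    have hind' : IndepFun (fun ω => |S ω| ^ p * (S ω)⁻¹) (X i) μ :=
      hind.comp hφm measurable_id
    have hφint : Integrable (fun ω => |S ω| ^ p * (S ω)⁻¹) μ := by
      refine ((integrable_const (1 : ℝ)).add ih1).mono'
        (hφm.comp hSm).aestronglyMeasurable (ae_of_all _ fun ω => ?_)
      exact abs_rpow_mul_inv_le hp _
    have hprod : Integrable (fun ω => |S ω| ^ p * (S ω)⁻¹ * X i ω) μ :=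
      hind'.integrable_mul hφint (hint i)
    have hprod0 : ∫ ω, |S ω| ^ p * (S ω)⁻¹ * X i ω ∂μ = 0 := by
      rw [hind'.integral_fun_mul_eq_mul_integral hφint.1 (hint i).1, hmean i, mul_zero]
    have hbint : Integrable (fun ω => |S ω| ^ p + p * (|S ω| ^ p * (S ω)⁻¹ * X i ω)
        + 2 * |X i ω| ^ p) μ := (ih1.add (hprod.const_mul p)).add ((hmom i).const_mul 2)
    have hle : ∀ ω, |∑ j ∈ insert i s, X j ω| ^ p ≤
        |S ω| ^ p + p * (|S ω| ^ p * (S ω)⁻¹ * X i ω) + 2 * |X i ω| ^ p := fun ω => by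
      rw [Finset.sum_insert hi, add_comm]
      exact abs_add_rpow_le hp hp2 _ _
    have hmeas : Measurable fun ω => |∑ j ∈ insert i s, X j ω| ^ p := by fun_prop
    have hI : Integrable (fun ω => |∑ j ∈ insert i s, X j ω| ^ p) μ := by
      refine hbint.mono' hmeas.aestronglyMeasurable (ae_of_all _ fun ω => ?_)
      rw [Real.norm_of_nonneg (by positivity)]
      exact hle ω
    refine ⟨hI, (integral_mono hI hbint hle).trans ?_⟩
    have hS1 : Integrable (fun ω => |S ω| ^ p) μ := ih1
    have hS2 : Integrable (fun ω => |S ω| ^ p + p * (|S ω| ^ p * (S ω)⁻¹ * X i ω)) μ :=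
      hS1.add (hprod.const_mul p)
    rw [integral_add hS2 ((hmom i).const_mul 2), integral_add hS1 (hprod.const_mul p), integral_const_mul, integral_const_mul, hprod0,
      Finset.sum_insert hi]
    linarith

/-- The power-mean inequality with exponent `2 / p ≥ 1`, then the power `p / 2` of both sides. -/
lemma sum_abs_rpow_le (s : Finset ι) (u : ι → ℝ) {p m σ : ℝ} (hp : 1 ≤ p) (hp2 : p ≤ 2)
    (hm : (s.card : ℝ) ≤ m) (hσ : 0 ≤ σ) (hu : ∑ i ∈ s, u i ^ 2 ≤ σ ^ 2) :
    ∑ i ∈ s, |u i| ^ p ≤ m ^ (1 - p / 2) * σ ^ p := by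
  have hp0 : 0 < p := by linarith
  have hm0 : 0 ≤ m := (Nat.cast_nonneg _).trans hm
  have hpow : ∀ i, (|u i| ^ p) ^ (2 / p) = u i ^ 2 := fun i => by
    rw [← Real.rpow_mul (abs_nonneg _), mul_div_cancel₀ _ hp0.ne', ← sq_abs]
    exact_mod_cast Real.rpow_natCast |u i| 2
  have h := Real.rpow_sum_le_const_mul_sum_rpow_of_nonneg s (f := fun i => |u i| ^ p)
    (p := 2 / p) (by rw [le_div_iff₀ hp0]; linarith) (fun i _ => by positivity)
  simp only [hpow] at h
  have hsum0 : 0 ≤ ∑ i ∈ s, |u i| ^ p := Finset.sum_nonneg fun i _ => by positivity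
  have hexp : (0 : ℝ) ≤ 2 / p - 1 := by rw [sub_nonneg, le_div_iff₀ hp0]; linarith
  have h2 : (∑ i ∈ s, |u i| ^ p) ^ (2 / p) ≤ m ^ (2 / p - 1) * σ ^ 2 :=
    h.trans (mul_le_mul (Real.rpow_le_rpow (Nat.cast_nonneg _) hm hexp) hu
      (Finset.sum_nonneg fun i _ => sq_nonneg _) (by positivity))
  have h3 := Real.rpow_le_rpow (by positivity) h2 (show 0 ≤ p / 2 by positivity)
  rw [← Real.rpow_mul hsum0, Real.mul_rpow (by positivity) (by positivity),
    ← Real.rpow_mul hm0] at h3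
  have e1 : 2 / p * (p / 2) = 1 := by field_simp
  have e2 : (2 / p - 1) * (p / 2) = 1 - p / 2 := by field_simp
  have e3 : (σ ^ 2) ^ (p / 2) = σ ^ p := by
    rw [← Real.rpow_natCast, ← Real.rpow_mul hσ]; congr 1; push_cast; field_simp
  rwa [e1, Real.rpow_one, e2, e3] at h3

/-- Tail bound for a linear combination of independent centred variables with bounded
`(1 + ε)`-th moment. -/
lemma measureReal_abs_sum_gt_le {ε v m σ : ℝ} (hε : 0 < ε) (hε1 : ε ≤ 1) (hv : 0 < v)
    (hm : 0 < m) (hσ : 0 < σ) {X : ι → Ω → ℝ} (hX : iIndepFun X μ) (hmeas : ∀ i, Measurable (X i))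
    (hint : ∀ i, Integrable (X i) μ) (hmean : ∀ i, ∫ ω, X i ω ∂μ = 0)
    (hmom : ∀ i, Integrable (fun ω => |X i ω| ^ (1 + ε)) μ)
    (hmomv : ∀ i, ∫ ω, |X i ω| ^ (1 + ε) ∂μ ≤ v)
    (s : Finset ι) (u : ι → ℝ) (hs : (s.card : ℝ) ≤ m) (hu : ∑ i ∈ s, u i ^ 2 ≤ σ ^ 2) :
    μ.real {ω | (12 * v) ^ (1 / (1 + ε)) * m ^ ((1 - ε) / (2 * (1 + ε))) * σ <
      |∑ i ∈ s, u i * X i ω|} ≤ 1 / 4 := by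
  have : IsProbabilityMeasure μ := hX.isProbabilityMeasure
  have hp : (1 : ℝ) ≤ 1 + ε := by linarith
  have hp2 : 1 + ε ≤ 2 := by linarith
  have hp0 : 0 < 1 + ε := by linarith
  have habs : ∀ i ω, |u i * X i ω| ^ (1 + ε) = |u i| ^ (1 + ε) * |X i ω| ^ (1 + ε) := fun i ω => by
    rw [abs_mul, Real.mul_rpow (abs_nonneg _) (abs_nonneg _)]
  obtain ⟨h1, h2⟩ := integral_abs_sum_rpow_le (μ := μ) (X := fun i ω => u i * X i ω) hp hp2
    (hX.comp (fun i z => u i * z) fun i => by fun_prop) (fun i => (hmeas i).const_mul _)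
    (fun i => (hint i).const_mul _) (fun i => by rw [integral_const_mul, hmean, mul_zero])
    (fun i => by simp only [habs]; exact (hmom i).const_mul _) s
  simp only [habs, integral_const_mul] at h2
  have h3 : ∫ ω, |∑ i ∈ s, u i * X i ω| ^ (1 + ε) ∂μ ≤
      2 * (v * (m ^ ((1 - ε) / 2) * σ ^ (1 + ε))) := by
    refine h2.trans ?_
    gcongr
    calc _ ≤ ∑ i ∈ s, |u i| ^ (1 + ε) * v := Finset.sum_le_sum fun i _ =>
          mul_le_mul_of_nonneg_left (hmomv i) (by positivity)
      _ = v * ∑ i ∈ s, |u i| ^ (1 + ε) := by rw [← Finset.sum_mul, mul_comm]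
      _ ≤ _ := by
        gcongr
        have := sum_abs_rpow_le s u hp hp2 hs hσ.le hu
        rwa [show 1 - (1 + ε) / 2 = (1 - ε) / 2 by ring] at this
  set γ := (12 * v) ^ (1 / (1 + ε)) * m ^ ((1 - ε) / (2 * (1 + ε))) * σ with hγ
  have hγ0 : 0 < γ := by positivity
  have hγp : γ ^ (1 + ε) = 12 * v * m ^ ((1 - ε) / 2) * σ ^ (1 + ε) := by
    rw [hγ, Real.mul_rpow (by positivity) hσ.le, Real.mul_rpow (by positivity) (by positivity),
      ← Real.rpow_mul (by positivity), ← Real.rpow_mul hm.le, one_div_mul_cancel hp0.ne',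
      Real.rpow_one]
    congr 3
    field_simp
  have h4 := mul_meas_ge_le_integral_of_nonneg (ae_of_all _ fun ω => by positivity) h1
    (γ ^ (1 + ε))
  have h5 : μ.real {ω | γ < |∑ i ∈ s, u i * X i ω|} ≤
      μ.real {ω | γ ^ (1 + ε) ≤ |∑ i ∈ s, u i * X i ω| ^ (1 + ε)} :=
    measureReal_mono fun ω hω => Real.rpow_le_rpow hγ0.le (le_of_lt hω) hp0.le
  have h6 := h4.trans h3
  have hD : 0 < v * (m ^ ((1 - ε) / 2) * σ ^ (1 + ε)) := by positivity
  -- The constant 12 against the 2 of von Bahr–Esseen gives probability at most `1/6`, below the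
  -- required `1/4`.
  have h7 : γ ^ (1 + ε) = 12 * (v * (m ^ ((1 - ε) / 2) * σ ^ (1 + ε))) := by rw [hγp]; ring
  rw [h7] at h6 h5
  have h8 := h5
  nlinarith

end HeavyTail

/-! ### Medians, majorities and an exponential Markov bound -/

section Majority

/-- If the median lies too far above `c`, so do all values above the median, which are at least
half; symmetrically below. -/
lemma SupBMM.IsMedian.majority_of_lt_abs_sub {r : ℕ} {u : Fin r → ℝ} {m c w : ℝ}
    (hm : SupBMM.IsMedian u m) (h : w < |m - c|) :
    r ≤ 2 * Set.ncard {j | w < |u j - c|} := by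
  rcases lt_abs.mp h with h | h
  · refine hm.2.trans (Nat.mul_le_mul_left _ (Set.ncard_le_ncard (fun j hj => ?_)))
    have hj : m ≤ u j := hj
    show w < |u j - c|
    exact lt_of_lt_of_le (by linarith) (le_abs_self _)
  · refine hm.1.trans (Nat.mul_le_mul_left _ (Set.ncard_le_ncard (fun j hj => ?_)))
    have hj : u j ≤ m := hj
    show w < |u j - c|
    exact lt_of_lt_of_le (by linarith) (neg_le_abs _)

/-- The ratio of the mean bound `3/2` of `3^(1_B)` to the threshold `√3` per play is at most `exp
(-1/8)`. Numerically it rests on `e < 3 < (4/3)^4`. -/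
lemma three_halves_le_sqrt_three_mul_exp : (3 / 2 : ℝ) ≤ √3 * Real.exp (-(1 / 8)) := by
  have h1 : Real.exp (1 / 8) ^ 8 ≤ 3 := by
    rw [← Real.exp_nat_mul]
    norm_num
    linarith [Real.exp_one_lt_d9]
  have h3 : Real.exp (1 / 8) ^ 2 ≤ 4 / 3 := by
    by_contra! h
    have := pow_lt_pow_left₀ h (by norm_num) (n := 4) (by norm_num)
    rw [← pow_mul] at this
    norm_num at this h1
    linarith
  have h4 : 3 / 2 * Real.exp (1 / 8) ≤ √3 := by
    apply Real.le_sqrt_of_sq_le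
    rw [mul_pow]; linarith
  rw [Real.exp_neg, ← div_eq_mul_inv, le_div_iff₀ (Real.exp_pos _)]
  exact h4

variable {Ω ι : Type*} {mΩ : MeasurableSpace Ω} {μ : Measure Ω}

/-- Peel off one factor at a time: it depends on a block of coordinates disjoint from those used by
`E` and the other factors. -/
lemma lintegral_indicator_mul_prod_of_iIndep {m : ι → MeasurableSpace Ω} (hle : ∀ i, m i ≤ mΩ)
    (hind : iIndep m μ) {r : ℕ} {S : Set ι} {T : Fin r → Set ι} (hST : ∀ j, Disjoint S (T j))
    (hT : Pairwise (Function.onFun Disjoint T)) {E : Set Ω} (hE : MeasurableSet[⨆ i ∈ S, m i] E)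
    {f : Fin r → Ω → ENNReal} (hf : ∀ j, Measurable[⨆ i ∈ T j, m i] (f j)) (J : Finset (Fin r)) :
    ∫⁻ ω, E.indicator 1 ω * ∏ j ∈ J, f j ω ∂μ = μ E * ∏ j ∈ J, ∫⁻ ω, f j ω ∂μ := by
  have hsup : ∀ U : Set ι, ⨆ i ∈ U, m i ≤ mΩ := fun U => iSup₂_le fun i _ => hle i
  induction J using Finset.induction_on with
  | empty => simp [lintegral_indicator_one (hsup _ _ hE)]
  | insert j J hj ih =>
    have hdis : Disjoint (S ∪ ⋃ k ∈ J, T k) (T j) := by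
      rw [Set.disjoint_union_left, Set.disjoint_iUnion₂_left]
      exact ⟨hST j, fun k hk => hT (by rintro rfl; exact hj hk)⟩
    have h1 : Measurable[⨆ i ∈ S ∪ ⋃ k ∈ J, T k, m i]
        (fun ω => E.indicator (1 : Ω → ENNReal) ω * ∏ k ∈ J, f k ω) := by
      refine Measurable.mul ?_ ?_
      · refine Measurable.indicator measurable_const ?_
        exact (biSup_mono fun i hi => Or.inl hi : ⨆ i ∈ S, m i ≤ _) _ hE
      · refine Finset.measurable_fun_prod _ fun k hk => (hf k).mono (biSup_mono fun i hi => ?_) le_rfl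
        exact Or.inr (Set.mem_biUnion hk hi)
    have h2 := lintegral_mul_eq_lintegral_mul_lintegral_of_independent_measurableSpace
      (hsup _) (hsup _) (indep_iSup_of_disjoint hle hind hdis) h1 (hf j)
    rw [Finset.prod_insert hj, mul_comm (∫⁻ ω, f j ω ∂μ), ← mul_assoc, ← ih, ← h2]
    refine lintegral_congr fun ω => ?_
    rw [Finset.prod_insert hj]; ring

/-- If independent events of probability at most `1/4` are also independent of `E`, then on `E` at
least half of them happen with conditional probability at most `exp (-r/8)`. -/
lemma measure_inter_majority_le [IsProbabilityMeasure μ] {m : ι → MeasurableSpace Ω}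
    (hle : ∀ i, m i ≤ mΩ) (hind : iIndep m μ) {r : ℕ} {S : Set ι} {T : Fin r → Set ι}
    (hST : ∀ j, Disjoint S (T j)) (hT : Pairwise (Function.onFun Disjoint T)) {E : Set Ω}
    (hE : MeasurableSet[⨆ i ∈ S, m i] E) {B : Fin r → Set Ω}
    (hB : ∀ j, MeasurableSet[⨆ i ∈ T j, m i] (B j)) (hB4 : ∀ j, μ.real (B j) ≤ 1 / 4) :
    μ (E ∩ {ω | r ≤ 2 * Set.ncard {j | ω ∈ B j}}) ≤
      ENNReal.ofReal (Real.exp (-(r / 8 : ℝ))) * μ E := by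
  classical
  have hsup : ∀ U : Set ι, ⨆ i ∈ U, m i ≤ mΩ := fun U => iSup₂_le fun i _ => hle i
  -- This is `3^(1_B)`, written additively; its mean is at most `1 + 2/4`. If at least half of the
  -- events occur, the product is at least `3^(r/2)`, and Markov's inequality applies.
  set f : Fin r → Ω → ENNReal := fun j ω => 1 + (B j).indicator (fun _ => 2) ω with hf
  have hfm : ∀ j, Measurable[⨆ i ∈ T j, m i] (f j) := fun j =>
    (Measurable.indicator measurable_const (hB j)).const_add 1
  have hprod := lintegral_indicator_mul_prod_of_iIndep hle hind hST hT hE hfm Finset.univ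
  have hfj : ∀ j, ∫⁻ ω, f j ω ∂μ ≤ ENNReal.ofReal (3 / 2) := fun j => by
    simp only [hf]
    rw [lintegral_add_left measurable_const, lintegral_indicator (hsup _ _ (hB j))]
    simp only [lintegral_const, measure_univ, mul_one, Measure.restrict_apply, Set.univ_inter,
      MeasurableSet.univ]
    rw [← ofReal_measureReal, show (1 : ENNReal) = ENNReal.ofReal 1 by simp,
      show (2 : ENNReal) = ENNReal.ofReal 2 by simp, ← ENNReal.ofReal_mul (by norm_num),
      ← ENNReal.ofReal_add (by norm_num) (by positivity)]
    exact ENNReal.ofReal_le_ofReal (by linarith [hB4 j])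
  set c : ENNReal := ENNReal.ofReal (√3 ^ r) with hc
  have hm : Measurable fun ω => E.indicator 1 ω * ∏ j, f j ω :=
    ((measurable_one.indicator (hsup _ _ hE))).mul
      (Finset.measurable_fun_prod _ fun j _ => (hfm j).mono (hsup _) le_rfl)
  have hsub : E ∩ {ω | r ≤ 2 * Set.ncard {j | ω ∈ B j}} ⊆
      {ω | c ≤ E.indicator 1 ω * ∏ j, f j ω} := by
    rintro ω ⟨hω, hr : r ≤ 2 * Set.ncard {j | ω ∈ B j}⟩
    have hval : ∀ j, f j ω = ENNReal.ofReal (if ω ∈ B j then 3 else 1) := fun j => by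
      by_cases h : ω ∈ B j
      · simp [hf, h]; norm_num
      · simp [hf, h]
    show c ≤ _
    rw [Set.indicator_of_mem hω, Pi.one_apply, one_mul, Finset.prod_congr rfl fun j _ => hval j,
      ← ENNReal.ofReal_prod_of_nonneg (fun j _ => by split_ifs <;> norm_num), hc]
    refine ENNReal.ofReal_le_ofReal ?_
    rw [Finset.prod_ite, Finset.prod_const_one, mul_one, Finset.prod_const]
    rw [Set.ncard_eq_toFinset_card'] at hr
    have h1 : (1 : ℝ) ≤ √3 := Real.one_le_sqrt.mpr (by norm_num)
    refine (pow_le_pow_right₀ h1 hr).trans ?_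
    rw [pow_mul, Real.sq_sqrt (by norm_num)]
    refine le_of_eq ?_
    congr 2
    ext j; simp
  have h1 : c * μ (E ∩ {ω | r ≤ 2 * Set.ncard {j | ω ∈ B j}}) ≤
      μ E * ENNReal.ofReal ((3 / 2) ^ r) := by
    refine (mul_le_mul_right (measure_mono hsub) _).trans ?_
    refine (mul_meas_ge_le_lintegral hm c).trans ?_
    rw [hprod, ENNReal.ofReal_pow (by norm_num)]
    refine mul_le_mul_right ((Finset.prod_le_prod' fun j _ => hfj j).trans ?_) _
    simp
  have h2 : ENNReal.ofReal ((3 / 2) ^ r) ≤ c * ENNReal.ofReal (Real.exp (-(r / 8 : ℝ))) := by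
    rw [hc, ← ENNReal.ofReal_mul (by positivity)]
    refine ENNReal.ofReal_le_ofReal ?_
    have := pow_le_pow_left₀ (by norm_num) three_halves_le_sqrt_three_mul_exp r
    rwa [mul_pow, ← Real.exp_nat_mul, show (r : ℝ) * -(1 / 8) = -(r / 8) by ring] at this
  have hc0 : c ≠ 0 := by rw [hc, ENNReal.ofReal_ne_zero_iff]; positivity
  have hct : c ≠ ⊤ := ENNReal.ofReal_ne_top
  rw [← ENNReal.mul_le_mul_iff_right hc0 hct]
  refine h1.trans ((mul_le_mul_right h2 _).trans (le_of_eq ?_))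
  ring

end Majority

namespace SupBMM

/-! ### Confidence intervals for a fixed index set -/

section FixedIndex

variable {d K r : ℕ} {x : Contexts d K}

lemma dotProduct_lsEstimator (Ψ : Finset (ℕ × Fin K)) (y : Payoffs K r) (j : Fin r)
    (u : Fin d → ℝ) :
    u ⬝ᵥ lsEstimator x y Ψ j =
      ∑ p ∈ Ψ, ((x p.1 p.2).ofLp ⬝ᵥ ((gram x Ψ)⁻¹ *ᵥ u)) * y p.1 j p.2 := by
  rw [lsEstimator, dotProduct_gram_inv, dotProduct_sum]
  simp only [dotProduct_smul, smul_eq_mul]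
  exact Finset.sum_congr rfl fun p _ => by rw [mul_comm, dotProduct_comm]

lemma alpha_nonneg {ε v : ℝ} (hv : 0 < v) (t : ℕ) : 0 ≤ alpha ε v t := by
  unfold alpha; positivity

lemma width_nonneg {ε v : ℝ} (hv : 0 < v) (Ψ : Finset (ℕ × Fin K)) (t : ℕ) (a : Fin K) :
    0 ≤ width ε v x Ψ t a := by
  have := alpha_nonneg (ε := ε) hv t
  unfold width; positivity

variable {ν : Measure (Payoffs K r)} {θ : EuclideanSpace ℝ (Fin d)} {ε v : ℝ}

lemma measureReal_width_lt_le [IsProbabilityMeasure ν] (h : IsHeavyTailedLinear ν x θ ε v)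
    (hε : 0 < ε) (hε1 : ε ≤ 1)
    (hv : 0 < v) (hθ : ‖θ‖ ≤ 1) (Ψ : Finset (ℕ × Fin K)) (hΨ : Set.InjOn Prod.fst (Ψ : Set (ℕ × Fin K)))
    (t : ℕ) (hcard : Ψ.card ≤ t) (a : Fin K) (j : Fin r) :
    ν.real {y | width ε v x Ψ t a <
      |(x t a).ofLp ⬝ᵥ lsEstimator x y Ψ j - inner ℝ (x t a) θ|} ≤ 1 / 4 := by
  set u := (x t a).ofLp with hu
  set c : ℕ × Fin K → ℝ := fun p => (x p.1 p.2).ofLp ⬝ᵥ ((gram x Ψ)⁻¹ *ᵥ u) with hc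
  set X : Ψ → Payoffs K r → ℝ := fun p y => y p.1.1 j p.1.2 - inner ℝ (x p.1.1 p.1.2) θ with hX
  have hsumX : ∀ y : Payoffs K r,
      ∑ p ∈ Ψ, c p * (y p.1 j p.2 - inner ℝ (x p.1 p.2) θ) = ∑ p : Ψ, c p * X p y := fun y => by
    rw [← Finset.sum_coe_sort Ψ]
  have hind : iIndepFun X ν := by
    -- Distinct pairs of `Ψ` belong to distinct rounds, so for fixed `j` their noises come from
    -- distinct, hence independent, plays.
    have hinj : Function.Injective fun p : Ψ => (p.1.1, j) := fun p q hpq =>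
      Subtype.ext (hΨ p.2 q.2 (Prod.mk.inj hpq).1)
    exact (h.indep.precomp hinj).comp
      (fun (p : Ψ) (z : Fin K → ℝ) => z p.1.2 - inner ℝ (x p.1.1 p.1.2) θ) fun p => by fun_prop
  set σ := √(invQuad x Ψ u) with hσ
  have hw : width ε v x Ψ t a = alpha ε v t * σ + σ := by
    rw [width, ← hu, hσ, invQuad]; ring
  have hdec : ∀ y : Payoffs K r, |u ⬝ᵥ lsEstimator x y Ψ j - inner ℝ (x t a) θ| ≤
      |∑ p : Ψ, c p * X p y| + σ := fun y => by
    rw [← ofLp_dotProduct_ofLp, dotProduct_lsEstimator_sub, ← hsumX y]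
    refine (abs_sub _ _).trans ?_
    gcongr
    exact abs_gram_inv_dotProduct_le x Ψ u hθ
  have hsum : ∑ p : Ψ, c p ^ 2 ≤ σ ^ 2 := by
    rw [hσ, Real.sq_sqrt (invQuad_nonneg _ _ _), Finset.sum_coe_sort Ψ (fun p => c p ^ 2)]
    exact sum_sq_le_invQuad x Ψ u
  -- The tail bound needs `σ > 0`. If `σ = 0`, all weights vanish and only the bias remains.
  rcases (Real.sqrt_nonneg (invQuad x Ψ u)).eq_or_lt with h0 | h0
  · have hc0 : ∀ p : Ψ, c p = 0 := fun p => by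
      have hs : ∑ p : Ψ, c p ^ 2 = 0 :=
        le_antisymm (hsum.trans (by rw [hσ, ← h0]; simp)) (Finset.sum_nonneg fun _ _ => sq_nonneg _)
      have := (Finset.sum_eq_zero_iff_of_nonneg fun _ _ => sq_nonneg _).mp hs p (Finset.mem_univ p)
      exact pow_eq_zero_iff (two_ne_zero) |>.mp this
    have hempty : {y : Payoffs K r | width ε v x Ψ t a <
        |u ⬝ᵥ lsEstimator x y Ψ j - inner ℝ (x t a) θ|} = ∅ := by
      rw [Set.eq_empty_iff_forall_notMem]
      intro y hy
      have hy : width ε v x Ψ t a < |u ⬝ᵥ lsEstimator x y Ψ j - inner ℝ (x t a) θ| := hy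
      have h1 := hdec y
      simp only [hc0, zero_mul, Finset.sum_const_zero, abs_zero, zero_add] at h1
      have h2 : 0 ≤ alpha ε v t * σ := mul_nonneg (alpha_nonneg hv t) (Real.sqrt_nonneg _)
      linarith
    rw [hempty]; simp
  · have hXm : ∀ p : Ψ, Measurable (X p) := fun p => by fun_prop
    have hmean : ∀ p : Ψ, ∫ y, X p y ∂ν = 0 := fun p => by
      rw [integral_sub (h.integrable _ _ _) (integrable_const _), h.mean]
      simp
    refine (measureReal_mono (fun y hy => ?_)).trans
      (measureReal_abs_sum_gt_le (X := X) hε hε1 hv (show (0 : ℝ) < (t : ℝ) + 1 by positivity) h0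
        hind hXm (fun p => (h.integrable _ _ _).sub (integrable_const _)) hmean
        (fun p => ?_) (fun p => ?_) Finset.univ (fun p => c p) ?_ hsum)
    · have hy : width ε v x Ψ t a < |u ⬝ᵥ lsEstimator x y Ψ j - inner ℝ (x t a) θ| := hy
      have h1 := hdec y
      show alpha ε v t * σ < |∑ p : Ψ, c p * X p y|
      linarith
    · have := h.integrable_moment p.1.1 j p.1.2
      simpa only [h.mean] using this
    · have := h.moment p.1.1 j p.1.2
      simpa only [h.mean] using this
    · rw [Finset.card_univ, Fintype.card_coe]
      have : (Ψ.card : ℝ) ≤ t := by exact_mod_cast hcard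
      linarith

/-- The σ-algebra generated by the payoffs of the plays in `S`. -/
abbrev playsSigma (K r : ℕ) (S : Set (ℕ × Fin r)) : MeasurableSpace (Payoffs K r) :=
  ⨆ p ∈ S, MeasurableSpace.comap (fun y : Payoffs K r => y p.1 p.2) inferInstance

lemma measurable_playsSigma {S : Set (ℕ × Fin r)} {p : ℕ × Fin r} (hp : p ∈ S) (a : Fin K) :
    Measurable[playsSigma K r S] fun y : Payoffs K r => y p.1 p.2 a := by
  have h : Measurable[playsSigma K r S] fun y : Payoffs K r => y p.1 p.2 :=
    (comap_measurable _).mono (le_iSup₂_of_le p hp le_rfl) le_rfl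
  exact (measurable_pi_apply a).comp h

/-- The event `E` is to be the event that the random index set equals `Ψ`: determined by payoffs of
rounds outside `Ψ`, it is independent of the `r` estimators, the `j`-th of which uses only the
`j`-th plays of the rounds in `Ψ`. -/
lemma measure_inter_estPayoff_le [IsProbabilityMeasure ν] (h : IsHeavyTailedLinear ν x θ ε v)
    (hε : 0 < ε) (hε1 : ε ≤ 1)
    (hv : 0 < v) (hθ : ‖θ‖ ≤ 1) (R : Rules K r) (Ψ : Finset (ℕ × Fin K))
    (hΨ : Set.InjOn Prod.fst (Ψ : Set (ℕ × Fin K)))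
    (t : ℕ) (hcard : Ψ.card ≤ t) (a : Fin K) {E : Set (Payoffs K r)}
    (hE : MeasurableSet[playsSigma K r {p | ∀ q ∈ Ψ, q.1 ≠ p.1}] E) :
    ν (E ∩ {y | width ε v x Ψ t a < |estPayoff R x y Ψ t a - inner ℝ (x t a) θ|}) ≤
      ENNReal.ofReal (Real.exp (-(r / 8 : ℝ))) * ν E := by
  refine (measure_mono (Set.inter_subset_inter_right E fun y hy => ?_)).trans
    (measure_inter_majority_le
      (m := fun p : ℕ × Fin r =>
        MeasurableSpace.comap (fun y : Payoffs K r => y p.1 p.2) inferInstance)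
      (fun p => Measurable.comap_le (by fun_prop)) h.indep.iIndep
      (S := {p | ∀ q ∈ Ψ, q.1 ≠ p.1}) (T := fun j => {p | (∃ q ∈ Ψ, q.1 = p.1) ∧ p.2 = j})
      (fun j => ?_) (fun i j hij => ?_) hE
      (B := fun j => {y | width ε v x Ψ t a <
        |(x t a).ofLp ⬝ᵥ lsEstimator x y Ψ j - inner ℝ (x t a) θ|})
      (fun j => ?_) fun j => measureReal_width_lt_le h hε hε1 hv hθ Ψ hΨ t hcard a j)
  · exact (R.isMedian_median _).majority_of_lt_abs_sub hy
  · rw [Set.disjoint_left]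
    rintro p hp ⟨⟨q, hq, hqp⟩, -⟩
    exact hp q hq hqp
  · rw [Function.onFun, Set.disjoint_left]
    rintro p ⟨-, hp⟩ ⟨-, hp'⟩
    exact hij (hp.symm.trans hp')
  · simp only [dotProduct_lsEstimator]
    have hm : Measurable[playsSigma K r {p | (∃ q ∈ Ψ, q.1 = p.1) ∧ p.2 = j}]
        fun y : Payoffs K r => ∑ p ∈ Ψ,
          ((x p.1 p.2).ofLp ⬝ᵥ ((gram x Ψ)⁻¹ *ᵥ (x t a).ofLp)) * y p.1 j p.2 :=
      Finset.measurable_fun_sum _ fun p hp =>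
        have hmem : (p.1, j) ∈ {q : ℕ × Fin r | (∃ q' ∈ Ψ, q'.1 = q.1) ∧ q.2 = j} :=
          ⟨⟨p, hp, rfl⟩, rfl⟩
        (measurable_const_mul _).comp (measurable_playsSigma hmem p.2)
    have habs : Measurable fun z : ℝ => |z - inner ℝ (x t a) θ| := by fun_prop
    exact (habs.comp hm) measurableSet_Ioi

end FixedIndex

end SupBMM

namespace SupBMM

/-! ### Structure of the index sets -/

section Structure

variable {d K r N : ℕ} {ε v : ℝ} {R : Rules K r} {x : Contexts d K} {y y' : Payoffs K r}
  {Ψ Ψ' : ℕ → Finset (ℕ × Fin K)} {t s : ℕ}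

/-- The condition under which the search for an arm ends at stage `s`. -/
def Stops (N : ℕ) (ε v : ℝ) (R : Rules K r) (x : Contexts d K) (y : Payoffs K r)
    (Ψ : ℕ → Finset (ℕ × Fin K)) (t s : ℕ) : Prop :=
  AllNarrow N ε v R x y Ψ t s ∨ (wideArms ε v R x y Ψ t s).Nonempty

lemma two_zpow_neg_nat (s : ℕ) : (2 : ℝ) ^ (-(s : ℤ)) = (1 / 2) ^ s := by
  rw [zpow_neg, zpow_natCast, one_div, inv_pow]

/-- If some candidate is wider than `1 / √N`, it is also wider than `2⁻ˢ` once `s` is large. -/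
lemma exists_stops (hN : 1 ≤ N) : ∃ s, 1 ≤ s ∧ Stops N ε v R x y Ψ t s := by
  have hN' : (0 : ℝ) < 1 / √N := by
    have : (0 : ℝ) < N := by exact_mod_cast hN
    positivity
  obtain ⟨n, hn⟩ := exists_pow_lt_of_lt_one hN' (show (1 / 2 : ℝ) < 1 by norm_num)
  refine ⟨n + 1, by omega, or_iff_not_imp_left.mpr fun h => ?_⟩
  unfold AllNarrow at h
  push Not at h
  obtain ⟨a, ha, haw⟩ := h
  refine ⟨a, ?_⟩
  rw [wideArms, Finset.mem_filter, two_zpow_neg_nat]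
  refine ⟨ha, lt_trans ?_ haw⟩
  refine lt_of_le_of_lt ?_ hn
  exact pow_le_pow_of_le_one (by norm_num) (by norm_num) (by omega)

/-- `N ≥ 1` makes the set of stopping stages nonempty, so the infimum is attained and is not the
default value `0`. -/
lemma stopStage_eq_iff (hN : 1 ≤ N) :
    stopStage N ε v R x y Ψ t = s ↔
      1 ≤ s ∧ Stops N ε v R x y Ψ t s ∧ ∀ σ, 1 ≤ σ → σ < s → ¬ Stops N ε v R x y Ψ t σ := by
  have hne : {s | 1 ≤ s ∧ (AllNarrow N ε v R x y Ψ t s ∨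
      (wideArms ε v R x y Ψ t s).Nonempty)}.Nonempty := exists_stops hN
  constructor
  · rintro rfl
    have := Nat.sInf_mem hne
    exact ⟨this.1, this.2, fun σ h1 h2 h3 => Nat.notMem_of_lt_sInf h2 ⟨h1, h3⟩⟩
  · rintro ⟨h1, h2, h3⟩
    refine le_antisymm (Nat.sInf_le ⟨h1, h2⟩) (le_csInf hne fun σ hσ => ?_)
    by_contra! h
    exact h3 σ hσ.1 h hσ.2

/-- Round `t` is an exploration at stage `s`. -/
def Explores (N : ℕ) (ε v : ℝ) (R : Rules K r) (x : Contexts d K) (y : Payoffs K r)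
    (Ψ : ℕ → Finset (ℕ × Fin K)) (t s : ℕ) : Prop :=
  stopStage N ε v R x y Ψ t = s ∧ ¬ AllNarrow N ε v R x y Ψ t s

lemma Explores.chooseArm_eq (h : Explores N ε v R x y Ψ t s) :
    chooseArm N ε v R x y Ψ t = R.explore t s (wideArms ε v R x y Ψ t s) := by
  obtain ⟨rfl, h⟩ := h
  rw [chooseArm, if_neg h]

lemma Explores.wideArms_nonempty (hN : 1 ≤ N) (h : Explores N ε v R x y Ψ t s) :
    (wideArms ε v R x y Ψ t s).Nonempty :=
  ((stopStage_eq_iff hN).mp h.1).2.1.resolve_left h.2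

open Classical in
lemma updateIndex_eq : updateIndex N ε v R x y Ψ t s =
    if Explores N ε v R x y Ψ t s ∧ s ≤ numStages N then
      insert (t, R.explore t s (wideArms ε v R x y Ψ t s)) (Ψ s) else Ψ s := by
  rw [updateIndex]
  by_cases h : Explores N ε v R x y Ψ t s ∧ s ≤ numStages N
  · rw [if_pos h, h.1.chooseArm_eq, if_pos]
    exact ⟨by rw [h.1.1]; exact h.1.2, h.1.1.symm, h.2⟩
  · rw [if_neg h, if_neg]
    rintro ⟨h1, h2, h3⟩
    exact h ⟨⟨h2.symm, by rwa [h2]⟩, h3⟩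

lemma index_succ_of_explores (h : Explores N ε v R x y (index N ε v R x y t) t s)
    (hs : s ≤ numStages N) : index N ε v R x y (t + 1) s =
      insert (t, arm N ε v R x y t) (index N ε v R x y t s) := by
  rw [index, updateIndex_eq, if_pos ⟨h, hs⟩, arm, h.chooseArm_eq]

lemma index_succ_of_not_explores (h : ¬ Explores N ε v R x y (index N ε v R x y t) t s) :
    index N ε v R x y (t + 1) s = index N ε v R x y t s := by
  rw [index, updateIndex_eq, if_neg fun h' => h h'.1]

lemma index_of_numStages_lt (hs : numStages N < s) (t : ℕ) : index N ε v R x y t s = ∅ := by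
  induction t with
  | zero => rfl
  | succ t ih => rw [index, updateIndex_eq, if_neg fun h => by omega, ih]

lemma index_subset_succ : index N ε v R x y t s ⊆ index N ε v R x y (t + 1) s := by
  rw [index, updateIndex_eq]
  split_ifs
  · exact Finset.subset_insert _ _
  · rfl

lemma index_mono {t' : ℕ} (h : t ≤ t') : index N ε v R x y t s ⊆ index N ε v R x y t' s := by
  induction t', h using Nat.le_induction with
  | base => rfl
  | succ n _ ih => exact ih.trans index_subset_succ

lemma mem_index_succ {p : ℕ × Fin K} (hp : p ∈ index N ε v R x y (t + 1) s) :
    (Explores N ε v R x y (index N ε v R x y t) t s ∧ p = (t, arm N ε v R x y t)) ∨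
      p ∈ index N ε v R x y t s := by
  by_cases h : Explores N ε v R x y (index N ε v R x y t) t s
  · rcases le_or_gt s (numStages N) with hs | hs
    · rw [index_succ_of_explores h hs, Finset.mem_insert] at hp
      exact hp.imp (fun hp => ⟨h, hp⟩) id
    · rw [index_of_numStages_lt hs] at hp
      simp at hp
  · exact Or.inr (by rwa [index_succ_of_not_explores h] at hp)

lemma fst_lt_of_mem_index {p : ℕ × Fin K} (hp : p ∈ index N ε v R x y t s) : p.1 < t := by
  induction t with
  | zero => simp [index] at hp
  | succ t ih =>
    rcases mem_index_succ hp with ⟨-, rfl⟩ | h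
    · simp
    · exact (ih h).trans (Nat.lt_succ_self t)

lemma notMem_index (a : Fin K) : (t, a) ∉ index N ε v R x y t s :=
  fun h => lt_irrefl _ (fst_lt_of_mem_index h)

/-- Every round occurs at most once in all index sets together. -/
lemma index_unique {s' : ℕ} {p q : ℕ × Fin K} (hp : p ∈ index N ε v R x y t s)
    (hq : q ∈ index N ε v R x y t s') (hpq : p.1 = q.1) : s = s' ∧ p = q := by
  induction t with
  | zero => simp [index] at hp
  | succ t ih =>
    rcases mem_index_succ hp with ⟨h1, rfl⟩ | h1 <;> rcases mem_index_succ hq with ⟨h2, rfl⟩ | h2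
    · exact ⟨h1.1.symm.trans h2.1, rfl⟩
    · exact absurd (fst_lt_of_mem_index h2) (by simp [← hpq])
    · exact absurd (fst_lt_of_mem_index h1) (by simp [hpq])
    · exact ih h1 h2

lemma injOn_fst_index : Set.InjOn Prod.fst (index N ε v R x y t s : Set (ℕ × Fin K)) :=
  fun _ hp _ hq hpq => (index_unique (Finset.mem_coe.mp hp) (Finset.mem_coe.mp hq) hpq).2

lemma card_index_le : (index N ε v R x y t s).card ≤ t := by
  classical
  rw [← Finset.card_image_of_injOn injOn_fst_index]
  refine (Finset.card_le_card (t := Finset.range t) fun τ hτ => ?_).trans (by simp)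
  obtain ⟨p, hp, rfl⟩ := Finset.mem_image.mp hτ
  exact Finset.mem_range.mpr (fst_lt_of_mem_index hp)

/-! ### The index set of a stage does not depend on the payoffs in it -/

lemma candidates_congr
    (h : ∀ σ < s, Ψ σ = Ψ' σ ∧ ∀ a, ucb ε v R x y (Ψ σ) t a = ucb ε v R x y' (Ψ' σ) t a) :
    candidates ε v R x y Ψ t s = candidates ε v R x y' Ψ' t s := by
  induction s with
  | zero => rfl
  | succ s ih =>
    rcases s with _ | s
    · rfl
    · rw [candidates, candidates, ih fun σ hσ => h σ (by omega)]
      simp only [(h (s + 1) (by omega)).2]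

lemma wideArms_congr (hc : candidates ε v R x y Ψ t s = candidates ε v R x y' Ψ' t s)
    (hs : Ψ s = Ψ' s) : wideArms ε v R x y Ψ t s = wideArms ε v R x y' Ψ' t s := by
  rw [wideArms, wideArms, hc, hs]

lemma allNarrow_congr (hc : candidates ε v R x y Ψ t s = candidates ε v R x y' Ψ' t s)
    (hs : Ψ s = Ψ' s) : AllNarrow N ε v R x y Ψ t s ↔ AllNarrow N ε v R x y' Ψ' t s := by
  rw [AllNarrow, AllNarrow, hc, hs]

lemma estPayoff_congr {B : Finset (ℕ × Fin K)} (h : ∀ p ∈ B, ∀ j, y p.1 j p.2 = y' p.1 j p.2)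
    (a : Fin K) : estPayoff R x y B t a = estPayoff R x y' B t a := by
  simp only [estPayoff, dotProduct_lsEstimator]
  congr 1
  ext j
  exact Finset.sum_congr rfl fun p hp => by rw [h p hp j]

/-- Changing payoffs inside the index set of stage `s` cannot change that set. By induction over
rounds, all stages up to `s` evolve alike: reaching stage `s` takes the estimates of lower stages,
and exploring there takes only widths. -/
lemma index_congr (hN : 1 ≤ N)
    (h : ∀ τ, (∀ p ∈ index N ε v R x y t s, p.1 ≠ τ) → y τ = y' τ) :
    index N ε v R x y t s = index N ε v R x y' t s := by
  suffices ∀ τ ≤ t, ∀ σ ≤ s, index N ε v R x y τ σ = index N ε v R x y' τ σ from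
    this t le_rfl s le_rfl
  intro τ hτ
  induction τ with
  | zero => exact fun σ _ => rfl
  | succ τ ih =>
    have ih := ih (by omega)
    have hu : ∀ σ < s, ∀ a, ucb ε v R x y (index N ε v R x y τ σ) τ a =
        ucb ε v R x y' (index N ε v R x y' τ σ) τ a := fun σ hσ a => by
      rw [ucb, ucb, ← ih σ hσ.le, estPayoff_congr fun p hp j => ?_]
      -- A round used by the estimate of a stage `σ < s` lies in no other index set, so the two
      -- payoff families agree there.
      rw [h p.1 fun q hq hqp => hσ.ne' (index_unique hq (index_mono (by omega) hp) hqp).1]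
    have hc : ∀ σ ≤ s, candidates ε v R x y (index N ε v R x y τ) τ σ =
        candidates ε v R x y' (index N ε v R x y' τ) τ σ := fun σ hσ =>
      candidates_congr fun ρ hρ => ⟨ih ρ (by omega), hu ρ (by omega)⟩
    have hnar : ∀ σ ≤ s, (AllNarrow N ε v R x y (index N ε v R x y τ) τ σ ↔
        AllNarrow N ε v R x y' (index N ε v R x y' τ) τ σ) := fun σ hσ =>
      allNarrow_congr (hc σ hσ) (ih σ hσ)
    have hwide : ∀ σ ≤ s, wideArms ε v R x y (index N ε v R x y τ) τ σ =
        wideArms ε v R x y' (index N ε v R x y' τ) τ σ := fun σ hσ =>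
      wideArms_congr (hc σ hσ) (ih σ hσ)
    have hstops : ∀ σ ≤ s, (Stops N ε v R x y (index N ε v R x y τ) τ σ ↔
        Stops N ε v R x y' (index N ε v R x y' τ) τ σ) := fun σ hσ => by
      rw [Stops, Stops, hnar σ hσ, hwide σ hσ]
    intro σ hσ
    have hexp : Explores N ε v R x y (index N ε v R x y τ) τ σ ↔
        Explores N ε v R x y' (index N ε v R x y' τ) τ σ := by
      rw [Explores, Explores, hnar σ hσ, stopStage_eq_iff hN, stopStage_eq_iff hN, hstops σ hσ]
      refine and_congr_left fun _ => and_congr_right fun _ => and_congr_right fun _ => ?_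
      exact forall_congr' fun ρ => forall_congr' fun _ => forall_congr' fun hρ =>
        not_congr (hstops ρ (by omega))
    rw [index, index, updateIndex_eq, updateIndex_eq, hwide σ hσ, ih σ hσ]
    classical exact if_congr (and_congr_left' hexp) rfl rfl

end Structure

end SupBMM

namespace SupBMM

/-! ### Measurability of the algorithm -/

section Measurability

variable {d K r N : ℕ} {ε v : ℝ} {R : Rules K r}

/-- Lets measurability for each fixed index set pass to the random index set, as there are only
countably many values. -/
lemma _root_.Measurable.apply_countable {α β γ : Type*} [MeasurableSpace α] [MeasurableSpace β]
    [MeasurableSpace γ] [Countable β] [MeasurableSingletonClass β] {g : α → β} {f : β → α → γ}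
    (hg : Measurable g) (hf : ∀ b, Measurable (f b)) : Measurable fun z => f (g z) z :=
  (measurable_from_prod_countable_right (f := fun q : β × α => f q.1 q.2) hf).comp
    (hg.prodMk measurable_id)

lemma continuous_gram (Ψ : Finset (ℕ × Fin K)) :
    Continuous fun x : Contexts d K => gram x Ψ := by
  refine continuous_const.add (continuous_finsetSum _ fun p _ => ?_)
  refine continuous_matrix fun i j => ?_
  simp only [Matrix.vecMulVec_apply]
  fun_prop

lemma measurable_gram_inv (Ψ : Finset (ℕ × Fin K)) (i j : Fin d) :
    Measurable fun x : Contexts d K => (gram x Ψ)⁻¹ i j := by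
  have h1 : Measurable fun x : Contexts d K => (gram x Ψ).det :=
    (continuous_gram Ψ).matrix_det.measurable
  have h2 : Measurable fun x : Contexts d K => (gram x Ψ).adjugate i j :=
    ((continuous_gram Ψ).matrix_adjugate.matrix_elem i j).measurable
  simp only [Matrix.inv_def, Ring.inverse_eq_inv', Matrix.smul_apply, smul_eq_mul]
  exact h1.inv.mul h2

lemma measurable_dotProduct_gram_inv (Ψ : Finset (ℕ × Fin K)) (p q : ℕ × Fin K) :
    Measurable fun x : Contexts d K =>
      (x p.1 p.2).ofLp ⬝ᵥ ((gram x Ψ)⁻¹ *ᵥ (x q.1 q.2).ofLp) := by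
  have hc : ∀ (p : ℕ × Fin K) (i : Fin d), Measurable fun x : Contexts d K => (x p.1 p.2).ofLp i :=
    fun p i => by fun_prop
  simp only [dotProduct, Matrix.mulVec]
  exact Finset.measurable_fun_sum _ fun i _ => (hc p i).mul
    (Finset.measurable_fun_sum _ fun j _ => (measurable_gram_inv Ψ i j).mul (hc q j))

lemma measurable_width (Ψ : Finset (ℕ × Fin K)) (t : ℕ) (a : Fin K) :
    Measurable fun x : Contexts d K => width ε v x Ψ t a :=
  (measurable_dotProduct_gram_inv Ψ (t, a) (t, a)).sqrt.const_mul _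

lemma measurable_estPayoff (Ψ : Finset (ℕ × Fin K)) (t : ℕ) (a : Fin K) :
    Measurable fun z : Contexts d K × Payoffs K r => estPayoff R z.1 z.2 Ψ t a := by
  refine R.measurable_median.comp (measurable_pi_lambda _ fun j => ?_)
  simp only [dotProduct_lsEstimator]
  refine Finset.measurable_fun_sum _ fun p _ => Measurable.mul ?_ (by fun_prop)
  exact (measurable_dotProduct_gram_inv Ψ p (t, a)).comp measurable_fst

lemma measurable_ucb (Ψ : Finset (ℕ × Fin K)) (t : ℕ) (a : Fin K) :
    Measurable fun z : Contexts d K × Payoffs K r => ucb ε v R z.1 z.2 Ψ t a :=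
  (measurable_estPayoff Ψ t a).add ((measurable_width Ψ t a).comp measurable_fst)

/-- Finsets carry the discrete σ-algebra. -/
local instance {α : Type*} : MeasurableSpace (Finset α) := ⊤

local instance {α : Type*} : DiscreteMeasurableSpace (Finset α) := ⟨fun _ => trivial⟩

lemma measurable_finset_of_mem {α β : Type*} [MeasurableSpace β] [Fintype α] {f : β → Finset α}
    (h : ∀ a, MeasurableSet {z | a ∈ f z}) : Measurable f := by
  refine measurable_to_countable' fun C => ?_
  have : f ⁻¹' {C} = ⋂ a, {z | a ∈ f z ↔ a ∈ C} := by
    ext z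
    simp [Finset.ext_iff]
  rw [this]
  refine MeasurableSet.iInter fun a => ?_
  by_cases ha : a ∈ C
  · simpa only [ha, iff_true] using h a
  · simp only [ha, iff_false]
    exact (h a).compl

lemma measurableSet_mem_finset {α β : Type*} [MeasurableSpace β] {f : β → Finset α}
    (hf : Measurable f) (a : α) : MeasurableSet {z | a ∈ f z} :=
  hf (MeasurableSet.of_discrete (s := {C : Finset α | a ∈ C}))

lemma measurableSet_setOf_imp {α : Type*} [MeasurableSpace α] {p q : α → Prop}
    (hp : MeasurableSet {z | p z}) (hq : MeasurableSet {z | q z}) :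
    MeasurableSet {z | p z → q z} :=
  measurableSet_setOfPred.2 ((measurableSet_setOfPred.1 hp).imp (measurableSet_setOfPred.1 hq))

lemma measurableSet_setOf_forall {α ι : Type*} [MeasurableSpace α] [Countable ι]
    {p : ι → α → Prop} (hp : ∀ i, MeasurableSet {z | p i z}) : MeasurableSet {z | ∀ i, p i z} :=
  measurableSet_setOfPred.2 (Measurable.forall fun i => measurableSet_setOfPred.1 (hp i))

lemma measurable_payoffs {α : Type*} {_ : MeasurableSpace α} {φ : α → Payoffs K r}
    (h : ∀ t j a, Measurable fun z => φ z t j a) : Measurable φ :=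
  measurable_pi_lambda _ fun t => measurable_pi_lambda _ fun j =>
    measurable_pi_lambda _ fun a => h t j a

variable {Ψ : Contexts d K × Payoffs K r → ℕ → Finset (ℕ × Fin K)}

lemma measurable_candidates (hΨ : ∀ s, Measurable fun z => Ψ z s) (t s : ℕ) :
    Measurable fun z : Contexts d K × Payoffs K r => candidates ε v R z.1 z.2 (Ψ z) t s := by
  induction s with
  | zero => exact measurable_const
  | succ s ih =>
    rcases s with _ | s
    · exact measurable_const
    have hu : ∀ a, Measurable fun z : Contexts d K × Payoffs K r =>
        ucb ε v R z.1 z.2 (Ψ z (s + 1)) t a := fun a =>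
      (hΨ (s + 1)).apply_countable fun B => measurable_ucb B t a
    refine measurable_finset_of_mem fun a => ?_
    simp only [candidates, Finset.mem_filter]
    exact (measurableSet_mem_finset ih a).inter (measurableSet_setOf_forall fun a' =>
      measurableSet_setOf_imp (measurableSet_mem_finset ih a')
        (measurableSet_le ((hu a').sub_const _) (hu a)))

lemma measurable_wideArms (hΨ : ∀ s, Measurable fun z => Ψ z s) (t s : ℕ) :
    Measurable fun z : Contexts d K × Payoffs K r => wideArms ε v R z.1 z.2 (Ψ z) t s := by
  refine measurable_finset_of_mem fun a => ?_
  simp only [wideArms, Finset.mem_filter]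
  refine (measurableSet_mem_finset (measurable_candidates hΨ t s) a).inter ?_
  exact measurableSet_lt measurable_const
    ((hΨ s).apply_countable fun B => (measurable_width B t a).comp measurable_fst)

lemma measurableSet_allNarrow (hΨ : ∀ s, Measurable fun z => Ψ z s) (t s : ℕ) :
    MeasurableSet {z : Contexts d K × Payoffs K r | AllNarrow N ε v R z.1 z.2 (Ψ z) t s} := by
  exact measurableSet_setOf_forall fun a => measurableSet_setOf_imp
    (measurableSet_mem_finset (measurable_candidates hΨ t s) a)
    (measurableSet_le ((hΨ s).apply_countable fun B =>
      (measurable_width B t a).comp measurable_fst) measurable_const)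

lemma measurableSet_explores (hN : 1 ≤ N) (hΨ : ∀ s, Measurable fun z => Ψ z s) (t s : ℕ) :
    MeasurableSet {z : Contexts d K × Payoffs K r | Explores N ε v R z.1 z.2 (Ψ z) t s} := by
  have hstops : ∀ s, MeasurableSet
      {z : Contexts d K × Payoffs K r | Stops N ε v R z.1 z.2 (Ψ z) t s} := fun s =>
    (measurableSet_allNarrow hΨ t s).union
      ((measurable_wideArms hΨ t s) (MeasurableSet.of_discrete (s := {C : Finset (Fin K) | C.Nonempty})))
  simp only [Explores, stopStage_eq_iff hN]
  refine MeasurableSet.inter ?_ (measurableSet_allNarrow hΨ t s).compl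
  exact (MeasurableSet.const _).inter ((hstops s).inter (measurableSet_setOf_forall fun σ =>
    measurableSet_setOf_imp (MeasurableSet.const _) (measurableSet_setOf_imp
      (MeasurableSet.const _) (hstops σ).compl)))

lemma measurable_index (hN : 1 ≤ N) (t s : ℕ) :
    Measurable fun z : Contexts d K × Payoffs K r => index N ε v R z.1 z.2 t s := by
  induction t generalizing s with
  | zero => exact measurable_const
  | succ t ih =>
    simp only [index, updateIndex_eq]
    refine Measurable.ite ((measurableSet_explores hN ih t s).inter (MeasurableSet.const _)) ?_
      (ih s)
    classical
    exact ((measurable_wideArms ih t s).prodMk (ih s)).apply_countable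
      (f := fun q _ => insert (t, R.explore t s q.1) q.2) fun q => measurable_const

lemma measurableSet_index_eq (hN : 1 ≤ N) (t s : ℕ) (B : Finset (ℕ × Fin K)) :
    MeasurableSet {z : Contexts d K × Payoffs K r | index N ε v R z.1 z.2 t s = B} :=
  measurable_index hN t s (MeasurableSet.of_discrete (s := {B}))

/-- The estimate of stage `s` for arm `a` in round `t` is outside its confidence interval. -/
def badSet (N : ℕ) (ε v : ℝ) (R : Rules K r) (θ : EuclideanSpace ℝ (Fin d)) (t s : ℕ) (a : Fin K) :
    Set (Contexts d K × Payoffs K r) :=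
  {z | width ε v z.1 (index N ε v R z.1 z.2 t s) t a <
    |estPayoff R z.1 z.2 (index N ε v R z.1 z.2 t s) t a - inner ℝ (z.1 t a) θ|}

lemma measurableSet_badSet (hN : 1 ≤ N) (θ : EuclideanSpace ℝ (Fin d)) (t s : ℕ) (a : Fin K) :
    MeasurableSet (badSet N ε v R θ t s a) := by
  refine measurableSet_lt ((measurable_index hN t s).apply_countable fun B =>
    (measurable_width B t a).comp measurable_fst) (Measurable.norm (Measurable.sub
      ((measurable_index hN t s).apply_countable fun B => measurable_estPayoff B t a) ?_))
  have h : Measurable fun z : Contexts d K × Payoffs K r => z.1 t a := by fun_prop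
  exact h.inner_const

/-- Given the contexts, the event that the index set of a stage is `B` is determined by the payoffs
of the rounds which are not in `B`. -/
lemma measurableSet_index_eq_playsSigma (hN : 1 ≤ N) (x : Contexts d K) (t s : ℕ)
    (B : Finset (ℕ × Fin K)) :
    MeasurableSet[playsSigma K r {p | ∀ q ∈ B, q.1 ≠ p.1}]
      {y : Payoffs K r | index N ε v R x y t s = B} := by
  classical
  set S : Set (ℕ × Fin r) := {p | ∀ q ∈ B, q.1 ≠ p.1} with hS
  -- Erase the payoffs of the rounds in `B`. By `index_congr` in both directions, this does not
  -- change whether the index set is `B`.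
  set φ : Payoffs K r → Payoffs K r := fun y τ j a => if (τ, j) ∈ S then y τ j a else 0 with hφ
  have hφm : Measurable[playsSigma K r S] φ := by
    refine measurable_payoffs fun τ j a => ?_
    by_cases h : (τ, j) ∈ S
    · simpa only [hφ, if_pos h] using measurable_playsSigma h a
    · simp only [hφ, if_neg h]
      exact measurable_const
  have hagree : ∀ y τ, (∀ p ∈ B, p.1 ≠ τ) → φ y τ = y τ := fun y τ h => by
    ext j a
    exact if_pos h
  have heq : {y : Payoffs K r | index N ε v R x y t s = B} =
      φ ⁻¹' {y | index N ε v R x y t s = B} := by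
    ext y
    constructor
    · rintro rfl
      exact (index_congr hN fun τ h => (hagree y τ h).symm).symm
    · intro h
      have h : index N ε v R x (φ y) t s = B := h
      show index N ε v R x y t s = B
      rw [← h]
      exact (index_congr hN fun τ h' => hagree y τ (by rwa [h] at h')).symm
  rw [heq]
  exact hφm (measurable_prodMk_left (measurableSet_index_eq hN t s B))

end Measurability

end SupBMM

namespace SupBMM

/-! ### All confidence intervals are valid with high probability -/

section GoodEvent

variable {d K r N : ℕ} {ε v : ℝ} {R : Rules K r} {θ : EuclideanSpace ℝ (Fin d)}

lemma mem_badSet {x : Contexts d K} {y : Payoffs K r} {t s : ℕ} {a : Fin K} :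
    (x, y) ∈ badSet N ε v R θ t s a ↔ width ε v x (index N ε v R x y t s) t a <
      |estPayoff R x y (index N ε v R x y t s) t a - inner ℝ (x t a) θ| := by
  rw [badSet, Set.mem_ofPred_eq]

/-- Split according to the value `B` of the index set. On each piece the fixed-set bound holds
relative to the probability of the piece, and these probabilities sum to at most 1. -/
lemma measure_badSet_section_le {x : Contexts d K} {ν : Measure (Payoffs K r)}
    [IsProbabilityMeasure ν] (h : IsHeavyTailedLinear ν x θ ε v) (hN : 1 ≤ N) (hε : 0 < ε)
    (hε1 : ε ≤ 1) (hv : 0 < v) (hθ : ‖θ‖ ≤ 1) (t s : ℕ) (a : Fin K) :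
    ν {y | (x, y) ∈ badSet N ε v R θ t s a} ≤ ENNReal.ofReal (Real.exp (-(r / 8 : ℝ))) := by
  set E : Finset (ℕ × Fin K) → Set (Payoffs K r) := fun B => {y | index N ε v R x y t s = B}
    with hE
  set D : Finset (ℕ × Fin K) → Set (Payoffs K r) := fun B =>
    {y | width ε v x B t a < |estPayoff R x y B t a - inner ℝ (x t a) θ|} with hD
  have hEm : ∀ B, MeasurableSet (E B) := fun B =>
    measurable_prodMk_left (measurableSet_index_eq hN t s B)
  have hcover : {y | (x, y) ∈ badSet N ε v R θ t s a} ⊆ ⋃ B, E B ∩ D B := fun y hy => by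
    rw [Set.mem_ofPred_eq, mem_badSet] at hy
    exact Set.mem_iUnion.mpr ⟨index N ε v R x y t s, rfl, hy⟩
  have hpart : ∀ B, ν (E B ∩ D B) ≤ ENNReal.ofReal (Real.exp (-(r / 8 : ℝ))) * ν (E B) := fun B => by
    -- An attained value `B` inherits the distinctness of rounds and the bound on its size from
    -- `index`.
    rcases (E B).eq_empty_or_nonempty with h0 | ⟨y, hy⟩
    · simp [h0]
    · have hy : index N ε v R x y t s = B := hy
      exact measure_inter_estPayoff_le h hε hε1 hv hθ R B (hy ▸ injOn_fst_index) t
        (hy ▸ card_index_le) a (measurableSet_index_eq_playsSigma hN x t s B)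
  have hdisj : Pairwise (Function.onFun Disjoint E) := fun B C hBC =>
    Set.disjoint_left.mpr fun y (hy : index N ε v R x y t s = B)
      (hy' : index N ε v R x y t s = C) => hBC (hy.symm.trans hy')
  calc _ ≤ ∑' B, ν (E B ∩ D B) := (measure_mono hcover).trans (measure_iUnion_le _)
    _ ≤ ∑' B, ENNReal.ofReal (Real.exp (-(r / 8 : ℝ))) * ν (E B) := ENNReal.tsum_le_tsum hpart
    _ = ENNReal.ofReal (Real.exp (-(r / 8 : ℝ))) * ν (⋃ B, E B) := by
        rw [ENNReal.tsum_mul_left, measure_iUnion hdisj hEm]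
    _ ≤ _ := mul_le_of_le_one_right' prob_le_one

variable {Ω : Type*} [MeasurableSpace Ω] {μ : Measure Ω} [IsProbabilityMeasure μ]

/-- Disintegrate the joint law over the contexts; the bound on the sections is uniform. -/
lemma measure_badSet_le (hN : 1 ≤ N) (hε : 0 < ε) (hε1 : ε ≤ 1) (hv : 0 < v) (hθ : ‖θ‖ ≤ 1)
    {X : Ω → Contexts d K} (hX : Measurable X) {Y : Ω → Payoffs K r} (hY : Measurable Y)
    (hlaw : ∀ᵐ x ∂(μ.map X), IsHeavyTailedLinear (condDistrib Y X μ x) x θ ε v)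
    (t s : ℕ) (a : Fin K) :
    μ {ω | (X ω, Y ω) ∈ badSet N ε v R θ t s a} ≤ ENNReal.ofReal (Real.exp (-(r / 8 : ℝ))) := by
  have hm := measurableSet_badSet (ε := ε) (v := v) (R := R) hN θ t s a
  have : IsProbabilityMeasure (μ.map X) := Measure.isProbabilityMeasure_map hX.aemeasurable
  have h1 : μ {ω | (X ω, Y ω) ∈ badSet N ε v R θ t s a} =
      (μ.map X ⊗ₘ condDistrib Y X μ) (badSet N ε v R θ t s a) := by
    rw [compProd_map_condDistrib hY.aemeasurable, Measure.map_apply (hX.prodMk hY) hm]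
    rfl
  rw [h1, Measure.compProd_apply hm]
  calc _ ≤ ∫⁻ _, ENNReal.ofReal (Real.exp (-(r / 8 : ℝ))) ∂(μ.map X) := by
        refine lintegral_mono_ae (hlaw.mono fun x hx => ?_)
        exact measure_badSet_section_le hx hN hε hε1 hv hθ t s a
    _ = _ := by simp

lemma measure_exists_badSet_le (hN : 1 ≤ N) (hε : 0 < ε) (hε1 : ε ≤ 1) (hv : 0 < v)
    (hθ : ‖θ‖ ≤ 1)
    {X : Ω → Contexts d K} (hX : Measurable X) {Y : Ω → Payoffs K r} (hY : Measurable Y)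
    (hlaw : ∀ᵐ x ∂(μ.map X), IsHeavyTailedLinear (condDistrib Y X μ x) x θ ε v) (S : ℕ) :
    μ {ω | ∃ t < N, ∃ s, 1 ≤ s ∧ s ≤ S ∧ ∃ a, (X ω, Y ω) ∈ badSet N ε v R θ t s a} ≤
      ENNReal.ofReal (N * S * K * Real.exp (-(r / 8 : ℝ))) := by
  set I := Finset.range N ×ˢ Finset.Icc 1 S ×ˢ (Finset.univ : Finset (Fin K)) with hI
  have hsub : {ω | ∃ t < N, ∃ s, 1 ≤ s ∧ s ≤ S ∧ ∃ a, (X ω, Y ω) ∈ badSet N ε v R θ t s a} ⊆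
      ⋃ i ∈ I, {ω | (X ω, Y ω) ∈ badSet N ε v R θ i.1 i.2.1 i.2.2} := by
    rintro ω ⟨t, ht, s, hs1, hs2, a, h⟩
    exact Set.mem_biUnion (x := (t, s, a)) (by simp [hI, ht, hs1, hs2]) h
  calc _ ≤ ∑ i ∈ I, μ {ω | (X ω, Y ω) ∈ badSet N ε v R θ i.1 i.2.1 i.2.2} :=
        (measure_mono hsub).trans (measure_biUnion_finset_le _ _)
    _ ≤ ∑ _i ∈ I, ENNReal.ofReal (Real.exp (-(r / 8 : ℝ))) :=
        Finset.sum_le_sum fun i _ => measure_badSet_le hN hε hε1 hv hθ hX hY hlaw _ _ _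
    _ = _ := by
        rw [Finset.sum_const, nsmul_eq_mul, hI, Finset.card_product, Finset.card_product]
        rw [Finset.card_range, Nat.card_Icc, Finset.card_univ, Fintype.card_fin,
          ENNReal.ofReal_mul (by positivity), Nat.add_sub_cancel, ← mul_assoc]
        congr 1
        push_cast
        rw [ENNReal.ofReal_mul (by positivity), ENNReal.ofReal_mul (by positivity)]
        simp

/-- Without observations there is no noise, and the bias fits in the width. So the stages beyond
`numStages` need no share of the union bound. `r ≥ 1` excludes the empty majority. -/
lemma abs_estPayoff_sub_le_of_index_empty (hr : 1 ≤ r) (hv : 0 < v) (hθ : ‖θ‖ ≤ 1)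
    (x : Contexts d K) (y : Payoffs K r) (t : ℕ) (a : Fin K) :
    |estPayoff R x y ∅ t a - inner ℝ (x t a) θ| ≤ width ε v x ∅ t a := by
  by_contra! h
  have h1 := (R.isMedian_median _).majority_of_lt_abs_sub h
  have h2 : {j | width ε v x ∅ t a <
      |(x t a).ofLp ⬝ᵥ lsEstimator x y ∅ j - inner ℝ (x t a) θ|} = ∅ := by
    refine Set.eq_empty_iff_forall_notMem.mpr fun j hj => ?_
    have hj : width ε v x ∅ t a <
        |(x t a).ofLp ⬝ᵥ lsEstimator x y ∅ j - inner ℝ (x t a) θ| := hj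
    refine not_le.mpr hj ?_
    rw [← ofLp_dotProduct_ofLp, dotProduct_lsEstimator_sub, Finset.sum_empty, zero_sub, abs_neg]
    refine (abs_gram_inv_dotProduct_le x ∅ _ hθ).trans ?_
    rw [width, ← invQuad]
    exact le_mul_of_one_le_left (Real.sqrt_nonneg _) (by linarith [alpha_nonneg (ε := ε) hv t])
  rw [h2, Set.ncard_empty] at h1
  omega

end GoodEvent

end SupBMM

namespace SupBMM

/-! ### Regret when all confidence intervals are valid -/

section Round

variable {d K r N : ℕ} {ε v : ℝ} {R : Rules K r} {x : Contexts d K} {y : Payoffs K r}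
  {Ψ : ℕ → Finset (ℕ × Fin K)} {t s : ℕ} {θ : EuclideanSpace ℝ (Fin d)} {a b : Fin K}

/-- The confidence intervals of round `t` are valid in all stages. -/
def Valid (ε v : ℝ) (R : Rules K r) (x : Contexts d K) (y : Payoffs K r)
    (Ψ : ℕ → Finset (ℕ × Fin K)) (t : ℕ) (θ : EuclideanSpace ℝ (Fin d)) : Prop :=
  ∀ s, 1 ≤ s → ∀ a, |estPayoff R x y (Ψ s) t a - inner ℝ (x t a) θ| ≤ width ε v x (Ψ s) t a

lemma Valid.le_ucb (h : Valid ε v R x y Ψ t θ) (hs : 1 ≤ s) (a : Fin K) :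
    inner ℝ (x t a) θ ≤ ucb ε v R x y (Ψ s) t a := by
  have := (abs_le.mp (h s hs a)).1
  rw [ucb]; linarith

lemma Valid.ucb_le (h : Valid ε v R x y Ψ t θ) (hs : 1 ≤ s) (a : Fin K) :
    ucb ε v R x y (Ψ s) t a ≤ inner ℝ (x t a) θ + 2 * width ε v x (Ψ s) t a := by
  have := (abs_le.mp (h s hs a)).2
  rw [ucb]; linarith

lemma width_le_of_not_stops (h : ¬ Stops N ε v R x y Ψ t s)
    (ha : a ∈ candidates ε v R x y Ψ t s) : width ε v x (Ψ s) t a ≤ (1 / 2) ^ s := by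
  by_contra! hw
  refine h (Or.inr ⟨a, ?_⟩)
  rw [wideArms, Finset.mem_filter, two_zpow_neg_nat]
  exact ⟨ha, hw⟩

lemma two_zpow_one_sub_nat (s : ℕ) : (2 : ℝ) ^ (1 - (s : ℤ)) = 2 * (1 / 2) ^ s := by
  rw [sub_eq_add_neg, zpow_add₀ (by norm_num), zpow_one, two_zpow_neg_nat]

/-- A best arm is never eliminated. -/
lemma Valid.best_mem_candidates (h : Valid ε v R x y Ψ t θ)
    (hb : ∀ a, inner ℝ (x t a) θ ≤ inner ℝ (x t b) θ)
    (hs : ∀ σ, 1 ≤ σ → σ < s → ¬ Stops N ε v R x y Ψ t σ) :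
    b ∈ candidates ε v R x y Ψ t s := by
  induction s with
  | zero => simp [candidates]
  | succ s ih =>
    rcases s with _ | s
    · simp [candidates]
    rw [candidates, Finset.mem_filter]
    refine ⟨ih fun σ h1 h2 => hs σ h1 (by omega), fun a' ha' => ?_⟩
    have hw := width_le_of_not_stops (hs (s + 1) (by omega) (by omega)) ha'
    have h1 := h.le_ucb (s := s + 1) (by omega) b
    have h2 := h.ucb_le (s := s + 1) (by omega) a'
    rw [two_zpow_one_sub_nat]
    linarith [hb a']

lemma exists_best (hK : 1 ≤ K) (θ : EuclideanSpace ℝ (Fin d)) (x : Contexts d K) (t : ℕ) :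
    ∃ b, (∀ a, inner ℝ (x t a) θ ≤ inner ℝ (x t b) θ) ∧
      ∀ a, gap θ x t a = inner ℝ (x t b) θ - inner ℝ (x t a) θ := by
  have : Nonempty (Fin K) := ⟨⟨0, hK⟩⟩
  obtain ⟨b, hb⟩ := Finite.exists_max fun a => (inner ℝ (x t a) θ : ℝ)
  refine ⟨b, hb, fun a => ?_⟩
  rw [gap]
  congr 1
  exact le_antisymm (ciSup_le hb) (le_ciSup
    (f := fun a' => (inner ℝ (x t a') θ : ℝ)) (Set.finite_range _).bddAbove b)

lemma gap_le_two (hK : 1 ≤ K) (hθ : ‖θ‖ ≤ 1) (hx : ∀ t a, ‖x t a‖ ≤ 1) (t : ℕ) (a : Fin K) :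
    gap θ x t a ≤ 2 := by
  obtain ⟨b, -, hb⟩ := exists_best hK θ x t
  have h : ∀ a, |(inner ℝ (x t a) θ : ℝ)| ≤ 1 := fun a =>
    (abs_real_inner_le_norm _ _).trans (mul_le_one₀ (hx t a) (norm_nonneg _) hθ)
  rw [hb]
  linarith [(abs_le.mp (h b)).2, (abs_le.mp (h a)).1]

/-- A best arm was still present at the preceding stage `σ = s - 1`. Surviving there costs at most
`2 · 2^(-σ)` in upper confidence bound, and twice the width adds another `2 · 2^(-σ)`; together this
is `8 · 2⁻ˢ`. For `s = 1` the trivial bound 2 suffices. -/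
lemma Valid.gap_le_of_mem_candidates (h : Valid ε v R x y Ψ t θ) (hK : 1 ≤ K) (hθ : ‖θ‖ ≤ 1)
    (hx : ∀ t a, ‖x t a‖ ≤ 1) (hs1 : 1 ≤ s)
    (hs : ∀ σ, 1 ≤ σ → σ < s → ¬ Stops N ε v R x y Ψ t σ)
    (ha : a ∈ candidates ε v R x y Ψ t s) : gap θ x t a ≤ 8 * (1 / 2) ^ s := by
  obtain ⟨s, rfl⟩ : ∃ n, s = n + 1 := ⟨s - 1, by omega⟩
  rcases s with _ | s
  · refine (gap_le_two hK hθ hx t a).trans (by norm_num)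
  obtain ⟨b, hb, hgap⟩ := exists_best hK θ x t
  rw [candidates, Finset.mem_filter, two_zpow_one_sub_nat] at ha
  have hbm := h.best_mem_candidates (s := s + 1) (N := N) hb fun σ h1 h2 => hs σ h1 (by omega)
  have h1 := ha.2 b hbm
  have hw := width_le_of_not_stops (hs (s + 1) (by omega) (by omega)) ha.1
  have h2 := h.le_ucb (s := s + 1) (by omega) b
  have h3 := h.ucb_le (s := s + 1) (by omega) a
  rw [hgap, pow_succ]
  linarith

lemma Valid.gap_le_of_explores (h : Valid ε v R x y Ψ t θ) (hN : 1 ≤ N) (hK : 1 ≤ K)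
    (hθ : ‖θ‖ ≤ 1) (hx : ∀ t a, ‖x t a‖ ≤ 1) (he : Explores N ε v R x y Ψ t s) :
    gap θ x t (chooseArm N ε v R x y Ψ t) ≤ 8 * (1 / 2) ^ s ∧
      (1 / 2) ^ s < width ε v x (Ψ s) t (chooseArm N ε v R x y Ψ t) := by
  obtain ⟨hs1, -, hs⟩ := (stopStage_eq_iff hN).mp he.1
  have hm := R.explore_mem t s _ (he.wideArms_nonempty hN)
  rw [he.chooseArm_eq]
  generalize R.explore t s (wideArms ε v R x y Ψ t s) = a at hm ⊢
  rw [wideArms, Finset.mem_filter, two_zpow_neg_nat] at hm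
  exact ⟨h.gap_le_of_mem_candidates hK hθ hx hs1 hs hm.1, hm.2⟩

/-- The exploited arm beats a best arm in upper confidence bound, so its gap is at most twice its
width. -/
lemma Valid.gap_le_of_forall_not_explores (h : Valid ε v R x y Ψ t θ) (hN : 1 ≤ N) (hK : 1 ≤ K)
    (he : ∀ s, ¬ Explores N ε v R x y Ψ t s) :
    gap θ x t (chooseArm N ε v R x y Ψ t) ≤ 2 * (1 / √N) := by
  set s := stopStage N ε v R x y Ψ t with hs
  have hnar : AllNarrow N ε v R x y Ψ t s := not_not.mp fun h' => he s ⟨hs.symm, h'⟩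
  obtain ⟨hs1, -, hst⟩ := (stopStage_eq_iff hN).mp hs.symm
  obtain ⟨b, hb, hgap⟩ := exists_best hK θ x t
  have hbm := h.best_mem_candidates hb hst
  obtain ⟨c, hc, hcmax⟩ := Finset.exists_max_image (candidates ε v R x y Ψ t s)
    (fun a => ucb ε v R x y (Ψ s) t a) ⟨b, hbm⟩
  have hne : (bestArms ε v R x y Ψ t s).Nonempty :=
    ⟨c, by rw [bestArms, Finset.mem_filter]; exact ⟨hc, hcmax⟩⟩
  have hm := R.exploit_mem t s _ hne
  rw [chooseArm, ← hs, if_pos hnar]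
  set a := R.exploit t s (bestArms ε v R x y Ψ t s)
  rw [bestArms, Finset.mem_filter] at hm
  have h1 := hm.2 b hbm
  have h2 := h.le_ucb hs1 b
  have h3 := h.ucb_le hs1 a
  have h4 := hnar a hm.1
  rw [hgap]
  linarith

/-- As `log 2 ≥ 1/2`, `s > log N` forces `2^s ≥ √N`. This is why `⌊log N⌋` stages suffice. -/
lemma half_pow_le_of_numStages_lt (hN : 1 ≤ N) (hs : numStages N < s) :
    (1 / 2 : ℝ) ^ s ≤ 1 / √N := by
  have hN0 : (0 : ℝ) < N := by exact_mod_cast hN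
  have h1 : Real.log N < s := Nat.lt_of_floor_lt hs
  have hlog2 : (1 / 2 : ℝ) ≤ Real.log 2 := by linarith [Real.log_two_gt_d9]
  rw [one_div, inv_pow, one_div]
  refine inv_anti₀ (Real.sqrt_pos.mpr hN0) ?_
  rw [← Real.log_le_log_iff (Real.sqrt_pos.mpr hN0) (by positivity), Real.log_sqrt hN0.le,
    Real.log_pow]
  have : (0 : ℝ) ≤ s := Nat.cast_nonneg s
  nlinarith

open Classical in
lemma Valid.gap_le (h : Valid ε v R x y Ψ t θ) (hN : 1 ≤ N) (hK : 1 ≤ K)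
    (hθ : ‖θ‖ ≤ 1) (hx : ∀ t a, ‖x t a‖ ≤ 1) (hv : 0 < v) :
    gap θ x t (chooseArm N ε v R x y Ψ t) ≤ 8 * (1 / √N) +
      8 * ∑ s ∈ Finset.Icc 1 (numStages N), if Explores N ε v R x y Ψ t s then
        width ε v x (Ψ s) t (chooseArm N ε v R x y Ψ t) else 0 := by
  have hnn : ∀ s, 0 ≤ if Explores N ε v R x y Ψ t s then
      width ε v x (Ψ s) t (chooseArm N ε v R x y Ψ t) else 0 := fun s => by
    split_ifs
    · exact width_nonneg hv _ _ _
    · rfl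
  have hsum := Finset.sum_nonneg fun s (_ : s ∈ Finset.Icc 1 (numStages N)) => hnn s
  have hsq : 0 ≤ 1 / √(N : ℝ) := by positivity
  by_cases he : ∃ s, Explores N ε v R x y Ψ t s
  · obtain ⟨s, he⟩ := he
    obtain ⟨h1, h2⟩ := h.gap_le_of_explores hN hK hθ hx he
    have hs1 := ((stopStage_eq_iff hN).mp he.1).1
    rcases le_or_gt s (numStages N) with hs | hs
    · have h3 := Finset.single_le_sum (fun s _ => hnn s) (Finset.mem_Icc.mpr ⟨hs1, hs⟩)
      rw [if_pos he] at h3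
      linarith
    · have := half_pow_le_of_numStages_lt hN hs
      linarith
  · have := h.gap_le_of_forall_not_explores hN hK (not_exists.mp he)
    linarith

end Round

/-! ### Elliptical potential and summation over rounds -/

section AllRounds

variable {d K r N : ℕ} {ε v : ℝ} {R : Rules K r} {x : Contexts d K} {y : Payoffs K r}
  {θ : EuclideanSpace ℝ (Fin d)}

open Classical in
/-- The elliptical potential bound for the index set of a stage. -/
lemma sum_invQuad_le (hx : ∀ t a, ‖x t a‖ ≤ 1) {s : ℕ} (hs : s ≤ numStages N) (n : ℕ) :
    ∑ t ∈ Finset.range n, (if Explores N ε v R x y (index N ε v R x y t) t s then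
      invQuad x (index N ε v R x y t s) (x t (arm N ε v R x y t)).ofLp else 0) ≤
      2 * (d * Real.log (1 + n)) := by
  have h : ∑ t ∈ Finset.range n, (if Explores N ε v R x y (index N ε v R x y t) t s then
      invQuad x (index N ε v R x y t s) (x t (arm N ε v R x y t)).ofLp else 0) ≤
      2 * Real.log (gram x (index N ε v R x y n s)).det := by
    induction n with
    | zero => simp [index, gram]
    | succ n ih =>
      rw [Finset.sum_range_succ]
      split_ifs with he
      · rw [index_succ_of_explores he hs]
        have := invQuad_le_log_det_sub x _ (notMem_index (N := N) (ε := ε) (v := v) (R := R)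
          (x := x) (y := y) (s := s) (t := n) (arm N ε v R x y n)) (hx _ _)
        linarith
      · rw [index_succ_of_not_explores he]
        linarith
  refine h.trans ?_
  have h1 := log_det_gram_le x (index N ε v R x y n s) fun p _ => hx _ _
  have h2 : Real.log (1 + ((index N ε v R x y n s).card : ℝ)) ≤ Real.log (1 + n) := by
    refine Real.log_le_log (by positivity) ?_
    have : ((index N ε v R x y n s).card : ℝ) ≤ n := by exact_mod_cast card_index_le
    linarith
  have h3 : (d : ℝ) * Real.log (1 + ((index N ε v R x y n s).card : ℝ)) ≤
    d * Real.log (1 + n) := by gcongr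
  linarith

lemma alpha_le {t : ℕ} (hε : 0 < ε) (hε1 : ε ≤ 1) (hv : 0 < v) (ht : t < N) : alpha ε v t ≤
    (12 * v) ^ (1 / (1 + ε)) * (N : ℝ) ^ ((1 - ε) / (2 * (1 + ε))) := by
  unfold alpha
  have : (t : ℝ) + 1 ≤ N := by exact_mod_cast ht
  have : 0 ≤ (1 - ε) / (2 * (1 + ε)) := div_nonneg (by linarith) (by linarith)
  gcongr

open Classical in
-- Cauchy–Schwarz over all pairs of round and stage, with the indicator of exploration as one
-- factor. A round explores at most one stage, so the indicators contribute `N`; each stage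
-- contributes one elliptical potential.
lemma sum_width_le (hε : 0 < ε) (hε1 : ε ≤ 1) (hv : 0 < v) (hx : ∀ t a, ‖x t a‖ ≤ 1) :
    ∑ t ∈ Finset.range N, ∑ s ∈ Finset.Icc 1 (numStages N),
      (if Explores N ε v R x y (index N ε v R x y t) t s then
        width ε v x (index N ε v R x y t s) t (arm N ε v R x y t) else 0) ≤
      ((12 * v) ^ (1 / (1 + ε)) * (N : ℝ) ^ ((1 - ε) / (2 * (1 + ε))) + 1) *
        (√N * √(numStages N * (2 * (d * Real.log (1 + N))))) := by
  set A := (12 * v) ^ (1 / (1 + ε)) * (N : ℝ) ^ ((1 - ε) / (2 * (1 + ε))) + 1 with hA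
  have hA0 : 0 ≤ A := by positivity
  set e : ℕ × ℕ → ℝ := fun p =>
    if Explores N ε v R x y (index N ε v R x y p.1) p.1 p.2 then 1 else 0 with he
  set q : ℕ × ℕ → ℝ := fun p =>
    if Explores N ε v R x y (index N ε v R x y p.1) p.1 p.2 then
      √(invQuad x (index N ε v R x y p.1 p.2) (x p.1 (arm N ε v R x y p.1)).ofLp) else 0 with hq
  set I := Finset.range N ×ˢ Finset.Icc 1 (numStages N) with hI
  have hle : ∀ t ∈ Finset.range N, ∀ s,
      (if Explores N ε v R x y (index N ε v R x y t) t s then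
        width ε v x (index N ε v R x y t s) t (arm N ε v R x y t) else 0) ≤
        A * (e (t, s) * q (t, s)) := fun t ht s => by
    simp only [he, hq]
    split_ifs
    · rw [width, one_mul, ← invQuad]
      gcongr
      rw [hA]
      gcongr
      exact alpha_le hε hε1 hv (Finset.mem_range.mp ht)
    · simp
  have hsum_e : ∑ p ∈ I, e p ^ 2 ≤ N := by
    rw [hI, Finset.sum_product]
    calc _ ≤ ∑ t ∈ Finset.range N, (1 : ℝ) := Finset.sum_le_sum fun t _ => by
          calc _ = ∑ s ∈ Finset.Icc 1 (numStages N),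
              if Explores N ε v R x y (index N ε v R x y t) t s then (1 : ℝ) else 0 :=
                Finset.sum_congr rfl fun s _ => by simp only [he]; split_ifs <;> norm_num
            _ ≤ ∑ s ∈ Finset.Icc 1 (numStages N),
              if stopStage N ε v R x y (index N ε v R x y t) t = s then (1 : ℝ) else 0 := by
                refine Finset.sum_le_sum fun s _ => ?_
                by_cases h : Explores N ε v R x y (index N ε v R x y t) t s
                · rw [if_pos h, if_pos h.1]
                · rw [if_neg h]; split_ifs <;> norm_num
            _ ≤ 1 := by
                rw [Finset.sum_ite_eq]
                split_ifs <;> norm_num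
      _ = N := by simp
  have hsum_q : ∑ p ∈ I, q p ^ 2 ≤ numStages N * (2 * (d * Real.log (1 + N))) := by
    rw [hI, Finset.sum_product_right]
    calc _ ≤ ∑ s ∈ Finset.Icc 1 (numStages N), 2 * (d * Real.log (1 + N)) :=
          Finset.sum_le_sum fun s hs => by
            refine le_trans (le_of_eq (Finset.sum_congr rfl fun t _ => ?_))
              (sum_invQuad_le (ε := ε) (v := v) (R := R) (y := y) hx (Finset.mem_Icc.mp hs).2 N)
            simp only [hq]
            split_ifs
            · rw [Real.sq_sqrt (invQuad_nonneg _ _ _)]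
            · simp
      _ = _ := by simp
  calc _ ≤ ∑ t ∈ Finset.range N, ∑ s ∈ Finset.Icc 1 (numStages N), A * (e (t, s) * q (t, s)) :=
        Finset.sum_le_sum fun t ht => Finset.sum_le_sum fun s _ => hle t ht s
    _ = A * ∑ p ∈ I, e p * q p := by
        rw [hI, Finset.sum_product, Finset.mul_sum]
        simp only [Finset.mul_sum]
    _ ≤ _ := by
        refine mul_le_mul_of_nonneg_left ?_ hA0
        refine (Real.sum_mul_le_sqrt_mul_sqrt I e q).trans ?_
        gcongr

/-- The regret per play of the complete rounds. -/
lemma sum_gap_arm_le (hN : 1 ≤ N) (hK : 1 ≤ K) (hε : 0 < ε) (hε1 : ε ≤ 1) (hv : 0 < v)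
    (hθ : ‖θ‖ ≤ 1) (hx : ∀ t a, ‖x t a‖ ≤ 1)
    (hgood : ∀ t < N, Valid ε v R x y (index N ε v R x y t) t θ) :
    ∑ t ∈ Finset.range N, gap θ x t (arm N ε v R x y t) ≤ 8 * √N +
      8 * (((12 * v) ^ (1 / (1 + ε)) * (N : ℝ) ^ ((1 - ε) / (2 * (1 + ε))) + 1) *
        (√N * √(numStages N * (2 * (d * Real.log (1 + N)))))) := by
  classical
  refine (Finset.sum_le_sum fun t ht =>
    (hgood t (Finset.mem_range.mp ht)).gap_le hN hK hθ hx hv).trans ?_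
  rw [Finset.sum_add_distrib, ← Finset.mul_sum, Finset.sum_const, Finset.card_range, nsmul_eq_mul]
  refine add_le_add (le_of_eq ?_) ?_
  · have hN0 : (0 : ℝ) < N := by exact_mod_cast hN
    have := Real.mul_self_sqrt hN0.le
    have h0 := Real.sqrt_pos.mpr hN0
    field_simp
    linarith
  · rw [← Finset.mul_sum]
    exact mul_le_mul_of_nonneg_left (sum_width_le hε hε1 hv hx) (by norm_num)

end AllRounds

end SupBMM

namespace SupBMM

/-! ### The regret bound -/

section Regret

variable {d K r : ℕ} {ε v : ℝ}

lemma sum_range_mul_div {r : ℕ} (hr : 0 < r) (N : ℕ) (f : ℕ → ℝ) :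
    ∑ n ∈ Finset.range (r * N), f (n / r) = r * ∑ t ∈ Finset.range N, f t := by
  induction N with
  | zero => simp
  | succ N ih =>
    rw [Nat.mul_succ, Finset.sum_range_add, ih, Finset.sum_range_succ, mul_add]
    congr 1
    rw [Finset.sum_congr rfl fun i hi => by
      rw [Nat.mul_add_div hr, Nat.div_eq_of_lt (Finset.mem_range.mp hi), add_zero]]
    simp

lemma regret_le {T : ℕ} {R : Rules K r} {θ : EuclideanSpace ℝ (Fin d)} {x : Contexts d K}
    {y : Payoffs K r} (hr : 0 < r) (hK : 1 ≤ K) (hθ : ‖θ‖ ≤ 1) (hx : ∀ t a, ‖x t a‖ ≤ 1)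
    (rest : ℕ → Fin K) :
    regret T ε v R θ x y rest ≤
      r * ∑ t ∈ Finset.range (T / r), gap θ x t (arm (T / r) ε v R x y t) + 2 * (T % r : ℕ) := by
  rw [regret, ← Nat.div_add_mod T r, Finset.sum_range_add, Nat.div_add_mod T r,
    ← sum_range_mul_div hr (T / r) fun t => gap θ x t (arm (T / r) ε v R x y t)]
  refine add_le_add (le_of_eq (Finset.sum_congr rfl fun n hn => ?_)) ?_
  · rw [if_pos (Nat.div_lt_of_lt_mul (Finset.mem_range.mp hn))]
  · refine (Finset.sum_le_sum fun n _ => gap_le_two hK hθ hx _ _).trans (le_of_eq ?_)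
    rw [Finset.sum_const, Finset.card_range, nsmul_eq_mul, mul_comm]

lemma gap_eq_zero_of_dim_zero (θ : EuclideanSpace ℝ (Fin 0)) (x : Contexts 0 K) (t : ℕ)
    (a : Fin K) : gap θ x t a = 0 := by
  have h : ∀ a, (inner ℝ (x t a) θ : ℝ) = 0 := fun a => by
    rw [Subsingleton.elim θ 0, inner_zero_right]
  simp [gap, h]

/-- Moving `r` inside the power leaves `r^(ε/(1+ε))`, and `ε / (1 + ε) ≤ 1/2`. -/
lemma mul_rpow_le_sqrt_mul_rpow {r N T : ℝ} (hr : 1 ≤ r) (hN : 0 ≤ N) (hrN : r * N ≤ T)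
    (hε : 0 < ε) (hε1 : ε ≤ 1) :
    r * N ^ (1 / (1 + ε)) ≤ √r * T ^ (1 / (1 + ε)) := by
  have hr0 : 0 < r := by linarith
  have h1 : r * N ^ (1 / (1 + ε)) = r ^ (ε / (1 + ε)) * (r * N) ^ (1 / (1 + ε)) := by
    rw [Real.mul_rpow hr0.le hN, ← mul_assoc, ← Real.rpow_add hr0]
    rw [show ε / (1 + ε) + 1 / (1 + ε) = 1 by rw [← add_div, add_comm, div_self (by linarith)],
      Real.rpow_one]
  rw [h1, Real.sqrt_eq_rpow]
  refine mul_le_mul (Real.rpow_le_rpow_of_exponent_le hr ?_)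
    (Real.rpow_le_rpow (by positivity) hrN (by positivity)) (by positivity) (by positivity)
  rw [div_le_div_iff₀ (by linarith) (by norm_num)]
  linarith

lemma regret_bound_of_complete_rounds {T N r : ℕ} {L s c : ℝ} (hd : 1 ≤ d) (hT : 2 ≤ T)
    (hN : 1 ≤ N) (hr : 2 ≤ r) (hL : 1 ≤ L) (hrL : (r : ℝ) ≤ 9 * L) (hrN : r * N ≤ T)
    (hε : 0 < ε) (hε1 : ε ≤ 1) (hc : 0 ≤ c) (hsN : s ≤ Real.log N) :
    r * (8 * √N + 8 * ((c * (N : ℝ) ^ ((1 - ε) / (2 * (1 + ε))) + 1) *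
        (√N * √(s * (2 * (d * Real.log (1 + N))))))) ≤
      120 * (1 + c) * Real.log T * √(2 * d * L) * (T : ℝ) ^ (1 / (1 + ε)) := by
  have hN1 : (1 : ℝ) ≤ N := by exact_mod_cast hN
  have hN0 : (0 : ℝ) < N := by linarith
  have hr1 : (1 : ℝ) ≤ r := by exact_mod_cast (by omega : 1 ≤ r)
  have hd1 : (1 : ℝ) ≤ d := by exact_mod_cast hd
  have hT2 : (2 : ℝ) ≤ T := by exact_mod_cast hT
  have hrNT : (r : ℝ) * N ≤ T := by exact_mod_cast hrN
  have hNT : (1 : ℝ) + N ≤ T := by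
    -- From `1 + N ≤ 2 N ≤ r N ≤ T`; this turns `log (1 + N)` into `log T`.
    have : 1 + N ≤ T := by nlinarith
    exact_mod_cast this
  have hlogT : 0.69 ≤ Real.log T := by
    have := Real.log_le_log (by norm_num) hT2
    linarith [Real.log_two_gt_d9]
  set P := (T : ℝ) ^ (1 / (1 + ε)) with hP
  set D := √(2 * d) with hD
  have hD1 : 1.4 ≤ D := Real.le_sqrt_of_sq_le (by norm_num; linarith)
  have hP0 : 0 ≤ P := by positivity
  have hsqrtr : √(r : ℝ) ≤ 3 * √L := by
    rw [show (3 : ℝ) = √9 by rw [show (9 : ℝ) = 3 ^ 2 by norm_num, Real.sqrt_sq (by norm_num)],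
      ← Real.sqrt_mul (by norm_num)]
    exact Real.sqrt_le_sqrt hrL
  have hexp : (1 : ℝ) / 2 ≤ 1 / (1 + ε) :=
    one_div_le_one_div_of_le (by linarith) (by linarith)
  have hsqrtN : √(N : ℝ) ≤ (N : ℝ) ^ (1 / (1 + ε)) := by
    rw [Real.sqrt_eq_rpow]
    exact Real.rpow_le_rpow_of_exponent_le hN1 hexp
  have hrNP : r * (N : ℝ) ^ (1 / (1 + ε)) ≤ 3 * √L * P :=
    (mul_rpow_le_sqrt_mul_rpow hr1 hN0.le hrNT hε hε1).trans
      (mul_le_mul_of_nonneg_right hsqrtr hP0)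
  have hrsN : r * √(N : ℝ) ≤ 3 * √L * P :=
    (mul_le_mul_of_nonneg_left hsqrtN (by linarith)).trans hrNP
  have hNN : (N : ℝ) ^ ((1 - ε) / (2 * (1 + ε))) * √N = (N : ℝ) ^ (1 / (1 + ε)) := by
    rw [Real.sqrt_eq_rpow, ← Real.rpow_add hN0]
    congr 1
    have : 1 + ε ≠ 0 := by linarith
    field_simp
    ring
  have hpot : √(s * (2 * (d * Real.log (1 + N)))) ≤ D * Real.log T := by
    rw [hD, show s * (2 * (d * Real.log (1 + N))) = 2 * d * (s * Real.log (1 + N)) by ring,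
      Real.sqrt_mul (by positivity)]
    refine mul_le_mul_of_nonneg_left (Real.sqrt_le_iff.mpr ⟨by linarith, ?_⟩) (Real.sqrt_nonneg _)
    rw [sq]
    refine mul_le_mul (hsN.trans (Real.log_le_log hN0 (by linarith)))
      (Real.log_le_log (by linarith) hNT) (Real.log_nonneg (by linarith)) (by linarith)
  have hmain : r * ((c * (N : ℝ) ^ ((1 - ε) / (2 * (1 + ε))) + 1) * √N) ≤
      (c + 1) * (3 * √L * P) := by
    calc _ = c * (r * ((N : ℝ) ^ ((1 - ε) / (2 * (1 + ε))) * √N)) + r * √N := by ring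
      _ ≤ c * (3 * √L * P) + 3 * √L * P := by rw [hNN]; gcongr
      _ = _ := by ring
  have hLP : 0 ≤ √L * P := by positivity
  have hDT : 0.96 ≤ D * Real.log T := by nlinarith
  rw [Real.sqrt_mul (show (0 : ℝ) ≤ 2 * d by positivity) L, ← hD]
  calc _ = 8 * (r * √N) + 8 * (r * ((c * (N : ℝ) ^ ((1 - ε) / (2 * (1 + ε))) + 1) * √N)) *
        √(s * (2 * (d * Real.log (1 + N)))) := by ring
    _ ≤ 8 * (3 * √L * P) + 8 * ((c + 1) * (3 * √L * P)) * (D * Real.log T) := by gcongr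
    _ = 24 * (√L * P) + 24 * ((1 + c) * (D * Real.log T) * (√L * P)) := by ring
    -- The exploitation term is absorbed using `(1 + c) D log T ≥ 0.96`, with room to spare, and `96
    -- + 24 = 120`.
    _ ≤ 96 * ((1 + c) * (D * Real.log T) * (√L * P)) +
        24 * ((1 + c) * (D * Real.log T) * (√L * P)) := by
        have : 0.96 ≤ (1 + c) * (D * Real.log T) := by nlinarith
        have := mul_le_mul_of_nonneg_right this hLP
        linarith
    _ = _ := by ring

/-- The number of left-over plays is at most both `T` and `8 L`, hence at most their geometric mean;
each loses at most 2. -/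
lemma left_over_le {T r : ℕ} {L : ℝ} (hr0 : 0 < r) (hr : (r : ℝ) < 8 * L + 1) :
    2 * ((T % r : ℕ) : ℝ) ≤ 5 * √(2 * T * L) := by
  have h1 : ((T % r : ℕ) : ℝ) ≤ T := by exact_mod_cast Nat.mod_le T r
  have h2 : ((T % r : ℕ) : ℝ) + 1 ≤ r := by exact_mod_cast Nat.mod_lt T hr0
  have h0 : (0 : ℝ) ≤ ((T % r : ℕ) : ℝ) := Nat.cast_nonneg _
  have h3 : ((T % r : ℕ) : ℝ) ^ 2 ≤ 4 * (2 * T * L) := by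
    rw [sq]
    calc _ ≤ (T : ℝ) * (8 * L) := mul_le_mul h1 (by linarith) h0 (Nat.cast_nonneg _)
      _ = _ := by ring
  have h4 : ((T % r : ℕ) : ℝ) / 2 ≤ √(2 * T * L) := Real.le_sqrt_of_sq_le (by linarith)
  have := Real.sqrt_nonneg (2 * T * L)
  linarith

lemma one_le_log_arg {K T : ℕ} (hK : 1 ≤ K) (hT : 2 ≤ T) {δ : ℝ} (hδ : 0 < δ) (hδ1 : δ < 1) :
    1 ≤ Real.log (2 * K * T * Real.log T / δ) := by
  have hK1 : (1 : ℝ) ≤ K := by exact_mod_cast hK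
  have hT2 : (2 : ℝ) ≤ T := by exact_mod_cast hT
  have hlogT : 0.69 ≤ Real.log T := by
    have := Real.log_le_log (by norm_num) hT2
    linarith [Real.log_two_gt_d9]
  have h1 : (2 : ℝ) ≤ K * T := by nlinarith
  -- In the extreme case `K = 1`, `T = 2` this reads `e ≤ 4 log 2`, where `4 · 0.69 = 2.76` is just
  -- enough.
  have h2 : Real.exp 1 ≤ 2 * K * T * Real.log T := by
    have : 2 * 0.69 ≤ K * T * Real.log T := by nlinarith
    nlinarith [Real.exp_one_lt_d9]
  rw [Real.le_log_iff_exp_le (by positivity), le_div_iff₀ hδ]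
  nlinarith [Real.exp_pos 1]

lemma failure_probability_le {K T N r : ℕ} {δ s : ℝ} (hK : 1 ≤ K) (hT : 2 ≤ T) (hδ : 0 < δ)
    (hN : 1 ≤ N) (hNT : N ≤ T) (hs0 : 0 ≤ s) (hs : s ≤ Real.log N)
    (hr : 8 * Real.log (2 * K * T * Real.log T / δ) ≤ r) :
    N * s * K * Real.exp (-(r / 8 : ℝ)) ≤ δ := by
  have hK1 : (1 : ℝ) ≤ K := by exact_mod_cast hK
  have hT2 : (2 : ℝ) ≤ T := by exact_mod_cast hT
  have hN1 : (1 : ℝ) ≤ N := by exact_mod_cast hN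
  have hNT' : (N : ℝ) ≤ T := by exact_mod_cast hNT
  have hlogT : 0 < Real.log T := Real.log_pos (by linarith)
  have h1 : Real.exp (-(r / 8 : ℝ)) ≤ δ / (2 * K * T * Real.log T) := by
    rw [← inv_div (2 * K * T * Real.log T) δ,
      ← Real.exp_log (show 0 < 2 * K * T * Real.log T / δ by positivity), ← Real.exp_neg]
    exact Real.exp_le_exp.mpr (by linarith)
  have hs' : s ≤ Real.log T := hs.trans (Real.log_le_log (by linarith) hNT')
  calc _ ≤ T * Real.log T * K * (δ / (2 * K * T * Real.log T)) := by
        gcongr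
    _ = δ / 2 := by field_simp
    _ ≤ δ := by linarith

/-- The regret bound for `r` plays per round, where `r = ⌈8L⌉`. -/
lemma regret_bound {Ω : Type*} [MeasurableSpace Ω] {μ : Measure Ω} [IsProbabilityMeasure μ]
    {T : ℕ} {δ L : ℝ} (hK : 1 ≤ K) (hT : 2 ≤ T) (hε : 0 < ε) (hε1 : ε ≤ 1) (hv : 0 < v)
    (hδ : 0 < δ) (hδ1 : δ < 1) (hL : L = Real.log (2 * K * T * Real.log T / δ))
    (hr8 : 8 * L ≤ r) (hr9 : (r : ℝ) < 8 * L + 1)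
    {θ : EuclideanSpace ℝ (Fin d)} (hθ : ‖θ‖ ≤ 1)
    {X : Ω → Contexts d K} (hX : Measurable X) (hX1 : ∀ᵐ ω ∂μ, ∀ t a, ‖X ω t a‖ ≤ 1)
    {Y : Ω → Payoffs K r} (hY : Measurable Y)
    (hlaw : ∀ᵐ x ∂(μ.map X), IsHeavyTailedLinear (condDistrib Y X μ x) x θ ε v) (R : Rules K r) :
    ENNReal.ofReal (1 - δ) ≤ μ {ω | ∀ rest : ℕ → Fin K,
      regret T ε v R θ (X ω) (Y ω) rest ≤
        120 * (1 + (12 * v) ^ (1 / (1 + ε))) * Real.log T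
          * √(2 * d * L) * (T : ℝ) ^ (1 / (1 + ε)) + 5 * √(2 * T * L)} := by
  have hL1 : 1 ≤ L := hL ▸ one_le_log_arg hK hT hδ hδ1
  have hr2 : 2 ≤ r := by
    have : (2 : ℝ) ≤ r := by linarith
    exact_mod_cast this
  have hT2 : (2 : ℝ) ≤ T := by exact_mod_cast hT
  have hlogT : 0 ≤ Real.log T := Real.log_nonneg (by linarith)
  have hleft := left_over_le (T := T) (L := L) (by omega) hr9
  have hmain0 : 0 ≤ 120 * (1 + (12 * v) ^ (1 / (1 + ε))) * Real.log T
      * √(2 * d * L) * (T : ℝ) ^ (1 / (1 + ε)) := by positivity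
  obtain ⟨N, hNT⟩ : ∃ N, N = T / r := ⟨_, rfl⟩
  have hlog : 1 ≤ N → (numStages N : ℝ) ≤ Real.log N := fun hN =>
    Nat.floor_le (Real.log_nonneg (by exact_mod_cast hN))
  have hbad : μ {ω | ∃ t < N, ∃ s, 1 ≤ s ∧ s ≤ numStages N ∧ ∃ a,
      (X ω, Y ω) ∈ badSet N ε v R θ t s a} ≤ ENNReal.ofReal δ := by
    rcases Nat.eq_zero_or_pos N with hN | hN
    · simp [hN]
    · refine (measure_exists_badSet_le hN hε hε1 hv hθ hX hY hlaw _).trans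
        (ENNReal.ofReal_le_ofReal ?_)
      exact failure_probability_le hK hT hδ hN (hNT ▸ Nat.div_le_self T r)
        (Nat.cast_nonneg _) (hlog hN) (hL ▸ hr8)
  generalize hB : {ω | ∃ t < N, ∃ s, 1 ≤ s ∧ s ≤ numStages N ∧ ∃ a,
      (X ω, Y ω) ∈ badSet N ε v R θ t s a} = B at hbad
  have hgood : ∀ᵐ ω ∂μ, ω ∈ Bᶜ → ∀ rest : ℕ → Fin K, regret T ε v R θ (X ω) (Y ω) rest ≤
      120 * (1 + (12 * v) ^ (1 / (1 + ε))) * Real.log T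
        * √(2 * d * L) * (T : ℝ) ^ (1 / (1 + ε)) + 5 * √(2 * T * L) := by
    filter_upwards [hX1] with ω hx hω rest
    refine (regret_le (by omega) hK hθ hx rest).trans (add_le_add ?_ hleft)
    rw [← hNT]
    rcases Nat.eq_zero_or_pos N with hN | hN
    · rw [hN, Finset.sum_range_zero, mul_zero]
      exact hmain0
    -- In dimension 0 the factor `√(2 d L)` vanishes and cannot absorb the exploitation term, but
    -- then all gaps are zero.
    rcases Nat.eq_zero_or_pos d with hd | hd
    · subst hd
      simp only [gap_eq_zero_of_dim_zero, Finset.sum_const_zero, mul_zero]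
      exact hmain0
    have hvalid : ∀ t < N, Valid ε v R (X ω) (Y ω) (index N ε v R (X ω) (Y ω) t) t θ := by
      intro t ht s hs a
      rcases le_or_gt s (numStages N) with hsS | hsS
      · by_contra! h
        rw [← hB] at hω
        exact hω ⟨t, ht, s, hs, hsS, a, mem_badSet.mpr h⟩
      · rw [index_of_numStages_lt hsS]
        exact abs_estPayoff_sub_le_of_index_empty (by omega) hv hθ _ _ _ _
    have hsum := sum_gap_arm_le hN hK hε hε1 hv hθ hx hvalid
    refine (mul_le_mul_of_nonneg_left hsum (Nat.cast_nonneg r)).trans ?_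
    exact regret_bound_of_complete_rounds hd hT hN hr2 hL1 (by linarith)
      (hNT ▸ Nat.mul_div_le T r) hε hε1 (by positivity) (hlog hN)
  -- Subadditivity of the outer measure suffices, so the measurability of the regret event, which
  -- quantifies over all `rest`, is not needed.
  have hadd : (1 : ENNReal) ≤ μ B + μ Bᶜ := by
    rw [← measure_univ (μ := μ), ← Set.union_compl_self B]
    exact measure_union_le _ _
  rw [ENNReal.ofReal_sub _ hδ.le, ENNReal.ofReal_one]
  refine tsub_le_iff_left.mpr (hadd.trans ?_)
  exact add_le_add hbad (measure_mono_ae hgood)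

end Regret

end SupBMM

theorem theorem1 {Ω : Type*} [MeasurableSpace Ω] (μ : Measure Ω) [IsProbabilityMeasure μ]
    (d K T : ℕ) (hK : 1 ≤ K) (hT : 2 ≤ T)
    (ε v δ : ℝ) (hε : 0 < ε) (hε1 : ε ≤ 1) (hv : 0 < v) (hδ : 0 < δ) (hδ1 : δ < 1)
    (θ : EuclideanSpace ℝ (Fin d)) (hθ : ‖θ‖ ≤ 1)
    (X : Ω → SupBMM.Contexts d K) (hX : Measurable X)
    (hX1 : ∀ᵐ ω ∂μ, ∀ t a, ‖X ω t a‖ ≤ 1)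
    (Y : Ω → SupBMM.Payoffs K (SupBMM.numPlays K T δ)) (hY : Measurable Y)
    (hlaw : ∀ᵐ x ∂(μ.map X), SupBMM.IsHeavyTailedLinear (condDistrib Y X μ x) x θ ε v)
    (R : SupBMM.Rules K (SupBMM.numPlays K T δ)) :
    ENNReal.ofReal (1 - δ) ≤
      μ {ω | ∀ rest : ℕ → Fin K,
        SupBMM.regret T ε v R θ (X ω) (Y ω) rest ≤
          120 * (1 + (12 * v) ^ (1 / (1 + ε))) * Real.log T
              * √(2 * d * Real.log (2 * K * T * Real.log T / δ)) * (T : ℝ) ^ (1 / (1 + ε))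
            + 5 * √(2 * T * Real.log (2 * K * T * Real.log T / δ))} := by
  have hL := SupBMM.one_le_log_arg hK hT hδ hδ1
  exact SupBMM.regret_bound hK hT hε hε1 hv hδ hδ1 rfl (Nat.le_ceil _)
    (Nat.ceil_lt_add_one (by linarith)) hθ hX hX1 hY hlaw R
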